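/- **Corollary 7.3 (Parallelized Osborne for uniformly sparse matrices).** Let $n\ge 2$ and let $K\in\mathbb{R}_{\ge 0}^{n\times n}$ be irreducible, i.e., the directed graph $G_K$ with vertices $[n]$ and edges $\{(i,j):K_{ij}>0\}$ is strongly connected. Let $m$ be the number of nonzero entries of $K$, $d$ the (directed) diameter of $G_K$, $\kappa=(\sum_{ij}K_{ij})/\min_{ij:K_{ij}>0}K_{ij}$, and $\Delta$ the maximum degree of the undirected loopless graph in which distinct $i,j$ are adjacent iff $(i,j)$ or $(j,i)$ is an edge of $G_K$ ("$K$ is $\Delta$-uniformly sparse"). Let $0<\varepsilon<2$. A vector $x\in\mathbb{R}^n$ is an $\varepsilon$-approximate balancing of $K$ if $A=\mathrm{diag}(e^x)K\,\mathrm{diag}(e^{-x})$ satisfies $\|r(A)-c(A)\|_1\le\varepsilon\sum_{ij}A_{ij}$, where $r(A)$ and $c(A)$ are the vectors of row and column sums. There are a deterministic distributed coloring algorithm and a universal constant $C$ such that, for all such $n,K,\Delta,\varepsilon$, the following parallel algorithm computes an $\varepsilon$-approximate balancing of $K$ almost surely. 1. *Coloring.* The coloring algorithm computes a proper coloring of the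 undirected graph above with color set $\{0,\dots,\Delta\}$. It is one finite program (the same for all inputs) run in synchronous rounds by $n$ processors, one for each vertex. Each processor is a random access machine over the natural numbers that knows $n$, $\Delta$, its identifier and its degree, reads one-word registers of its neighbors, and sleeps between the rounds in which it chooses to be awake. Its work is the total number of elementary steps of all processors. 2. *Random Block Osborne.* After one round and $n+m$ operations to compute the row and column sums of $K$, start at $x=\mathbf 0$. As long as $A=\mathrm{diag}(e^x)K\,\mathrm{diag}(e^{-x})$ is not $\varepsilon$-balanced, draw a color $\ell$ uniformly from the $\Delta+1$ colors, independently of the past, and simultaneously replace $x_k$ by $x_k+\tfrac12(\log c_k(A)-\log r_k(A))$ for all $k$ of color $\ell$. Each such step is one round; its work is $1$ plus, for each updated $k$, $1$ plus the number of nonzero entries in row $k$ plus the number of nonzero entries in column $k$. The total number $N$ of rounds and the total work $W$ of both stages satisfy: * (Expectation) $\mathbb{E}[N]\le C\,\frac{\Delta}{\varepsilon}\left(\frac1\varepsilon\wedge d\right)\log\kappa$ and $\mathbb{E}[W]\le C\,\frac{m}{\varepsilon}\left(\frac1\varepsilon\wedge d\right)\log\kappa$. * (High probability) For every $\delta\in(0,\tfrac12]$,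 with probability at least $1-\delta$, both $N\le C\,\frac{\Delta}{\varepsilon}\left(\frac1\varepsilon\wedge d\right)\log\kappa\,\log\frac1\delta$ and $W\le C\,\frac{m}{\varepsilon}\left(\frac1\varepsilon\wedge d\right)\log\kappa\,\log\frac1\delta$. -/

import Mathlib

open MeasureTheory ProbabilityTheory
open scoped ENNReal

noncomputable section

namespace ParBalance

/-! ### Nonnegative matrices: scalings, imbalance, parameters -/

section Balancing

variable {n : ℕ}

/-- Row sum `r_k(A)`. -/
def rowSum (A : Matrix (Fin n) (Fin n) ℝ) (k : Fin n) : ℝ := ∑ j, A k j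

/-- Column sum `c_k(A)`. -/
def colSum (A : Matrix (Fin n) (Fin n) ℝ) (k : Fin n) : ℝ := ∑ i, A i k

/-- Sum of all entries. -/
def total (A : Matrix (Fin n) (Fin n) ℝ) : ℝ := ∑ i, ∑ j, A i j

/-- The scaling `diag(e^x) K diag(e^{-x})`. -/
def scaling (K : Matrix (Fin n) (Fin n) ℝ) (x : Fin n → ℝ) : Matrix (Fin n) (Fin n) ℝ :=
  Matrix.diagonal (fun i => Real.exp (x i)) * K * Matrix.diagonal (fun i => Real.exp (-x i))

/-- `A` is `ε`-balanced: `‖r(A) - c(A)‖₁ / ∑ A_ij ≤ ε`. -/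
def IsEpsBalanced (ε : ℝ) (A : Matrix (Fin n) (Fin n) ℝ) : Prop :=
  (∑ k, |rowSum A k - colSum A k|) / total A ≤ ε

open Classical in
/-- `m`: the number of nonzero entries of `K`. -/
def nnz (K : Matrix (Fin n) (Fin n) ℝ) : ℕ :=
  (Finset.univ.filter fun e : Fin n × Fin n => K e.1 e.2 ≠ 0).card

open Classical in
/-- The number of nonzero entries in row `k`, plus the number of nonzero entries in column `k`. -/
def nnzAt (K : Matrix (Fin n) (Fin n) ℝ) (k : Fin n) : ℕ :=
  (Finset.univ.filter fun j => K k j ≠ 0).card + (Finset.univ.filter fun i => K i k ≠ 0).card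

/-- The least positive entry of `K`. -/
def minPosEntry (K : Matrix (Fin n) (Fin n) ℝ) : ℝ := sInf {a | ∃ i j, 0 < K i j ∧ a = K i j}

/-- `κ = (∑ K_ij) / K_min`. -/
def kappa (K : Matrix (Fin n) (Fin n) ℝ) : ℝ := total K / minPosEntry K

/-- Length of a shortest directed path from `i` to `j` in the digraph `G_K` of `K`
(vertices `Fin n`, an edge from `i` to `j` whenever `0 < K i j`). -/
def dirDist (K : Matrix (Fin n) (Fin n) ℝ) (i j : Fin n) : ℕ :=
  sInf {l | ∃ p : @Quiver.Path (Fin n) K.toQuiver i j, @Quiver.Path.length _ K.toQuiver _ _ p = l}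

/-- `d`: the diameter of the (strongly connected) digraph `G_K`. -/
def dirDiam (K : Matrix (Fin n) (Fin n) ℝ) : ℕ :=
  Finset.univ.sup fun e : Fin n × Fin n => dirDist K e.1 e.2

/-- The undirected simple graph underlying `G_K`: distinct `i`, `j` are adjacent when
`(i, j)` or `(j, i)` is an edge of `G_K`. -/
def supportGraph (K : Matrix (Fin n) (Fin n) ℝ) : SimpleGraph (Fin n) :=
  SimpleGraph.fromRel fun i j => 0 < K i j

open Classical in
/-- The maximum degree of the undirected graph underlying `G_K`. -/
def maxDeg (K : Matrix (Fin n) (Fin n) ℝ) : ℕ := (supportGraph K).maxDegree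

open Classical in
/-- The neighbours of `k` in the undirected graph underlying `G_K`, in increasing order. -/
def neighbours (K : Matrix (Fin n) (Fin n) ℝ) (k : Fin n) : List (Fin n) :=
  ((supportGraph K).neighborFinset k).sort

end Balancing

/-! ### A synchronous message-passing machine with step counts

One processor per vertex of a graph. Each is a random access machine with natural number cells,
and all of them run the same finite program. Time is divided into synchronous rounds. A processor
chooses the round in which it wakes up next; in a round, the awake processors run the program once,
during which they can read the public word (cell 0) that a neighbour had at the start of
the round. Sleeping processors do nothing. Every elementary step of every awake processor is
counted. -/

section Machine

/-- Programs; `M` denotes the memory of the processor. -/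
inductive Cmd : Type
  /-- `M[a] := v` -/
  | set (a v : ℕ)
  /-- `M[a] := M[b] + M[c]` -/
  | add (a b c : ℕ)
  /-- `M[a] := max (M[b] - M[c]) 0` -/
  | sub (a b c : ℕ)
  /-- `M[a] := M[b] * M[c]` -/
  | mul (a b c : ℕ)
  /-- `M[a] := ⌊M[b] / M[c]⌋` -/
  | div (a b c : ℕ)
  /-- `M[a] := M[b] mod M[c]` -/
  | mod (a b c : ℕ)
  /-- `M[a] := M[M[b]]` -/
  | load (a b : ℕ)
  /-- `M[M[a]] := M[b]` -/
  | store (a b : ℕ)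
  /-- `M[a] :=` the public word of neighbour number `M[b]` (counted from 0) -/
  | recv (a b : ℕ)
  /-- first `c`, then `d` -/
  | seq (c d : Cmd)
  /-- if `M[a] < M[b]` then `c`, else `d` -/
  | ifLt (a b : ℕ) (c d : Cmd)
  /-- repeat `c`; the number of repetitions is the value of `M[a]` when the loop is entered -/
  | loop (a : ℕ) (c : Cmd)

/-- Execution of a program. The state consists of the memory and the number of steps made so far:
every elementary instruction, every test and every loop entry and repetition costs one step.
`nb i` is the public word of neighbour number `i`. -/
def exec (nb : ℕ → ℕ) : Cmd → (ℕ → ℕ) × ℕ → (ℕ → ℕ) × ℕ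
  | .set a v, s => (Function.update s.1 a v, s.2 + 1)
  | .add a b c, s => (Function.update s.1 a (s.1 b + s.1 c), s.2 + 1)
  | .sub a b c, s => (Function.update s.1 a (s.1 b - s.1 c), s.2 + 1)
  | .mul a b c, s => (Function.update s.1 a (s.1 b * s.1 c), s.2 + 1)
  | .div a b c, s => (Function.update s.1 a (s.1 b / s.1 c), s.2 + 1)
  | .mod a b c, s => (Function.update s.1 a (s.1 b % s.1 c), s.2 + 1)
  | .load a b, s => (Function.update s.1 a (s.1 (s.1 b)), s.2 + 1)
  | .store a b, s => (Function.update s.1 (s.1 a) (s.1 b), s.2 + 1)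
  | .recv a b, s => (Function.update s.1 a (nb (s.1 b)), s.2 + 1)
  | .seq c d, s => exec nb d (exec nb c s)
  | .ifLt a b c d, s =>
      if s.1 a < s.1 b then exec nb c (s.1, s.2 + 1) else exec nb d (s.1, s.2 + 1)
  | .loop a c, s => (fun u => exec nb c (u.1, u.2 + 1))^[s.1 a] (s.1, s.2 + 1)

variable {n : ℕ}

/-- The memories of the processors before round 0. Cell 0 is the public word and cell 1 the number
of the round in which the processor wakes up next (all wake up in round 0). Cells 2 to 5
contain the number of processors, the parameter `Δ`, the identifier of the processor, and
its number of neighbours. All other cells are 0. -/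
def netInit (nbrs : Fin n → List (Fin n)) (Δ : ℕ) (k : Fin n) (a : ℕ) : ℕ :=
  if a = 2 then n else if a = 3 then Δ else if a = 4 then (k : ℕ)
    else if a = 5 then (nbrs k).length else 0

/-- One activation of processor `k` in round `t`: cell 6 is loaded with the round number `t`,
and the program is run. The activation itself costs one step. -/
def activate (prog : Cmd) (nbrs : Fin n → List (Fin n)) (t : ℕ) (mem : Fin n → ℕ → ℕ)
    (k : Fin n) : (ℕ → ℕ) × ℕ :=
  exec (fun i => (((nbrs k)[i]?).map fun j => mem j 0).getD 0) prog
    (Function.update (mem k) 6 t, 1)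

/-- The memories of the processors at the start of round `t`. -/
def netState (prog : Cmd) (nbrs : Fin n → List (Fin n)) (Δ : ℕ) : ℕ → Fin n → ℕ → ℕ
  | 0 => netInit nbrs Δ
  | t + 1 => fun k =>
      if netState prog nbrs Δ t k 1 = t then
        (activate prog nbrs t (netState prog nbrs Δ t) k).1
      else netState prog nbrs Δ t k

/-- No processor wakes up in round `R` or later, so the computation is over after `R` rounds. -/
def HaltsWithin (prog : Cmd) (nbrs : Fin n → List (Fin n)) (Δ R : ℕ) : Prop :=
  ∀ k, netState prog nbrs Δ R k 1 < R

/-- The total number of steps made by all processors in rounds `0, …, R - 1`. -/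
def netWork (prog : Cmd) (nbrs : Fin n → List (Fin n)) (Δ R : ℕ) : ℕ :=
  ∑ t ∈ Finset.range R, ∑ k,
    if netState prog nbrs Δ t k 1 = t then
      (activate prog nbrs t (netState prog nbrs Δ t) k).2
    else 0

/-- On the graph of `K`, the program `prog` halts within `R` rounds and its public words are then
the proper colouring `col` with `Δ + 1` colours. -/
def ComputesColouring (prog : Cmd) (K : Matrix (Fin n) (Fin n) ℝ) (Δ R : ℕ)
    (col : Fin n → Fin (Δ + 1)) : Prop :=
  HaltsWithin prog (neighbours K) Δ R ∧
  (∀ k, netState prog (neighbours K) Δ R k 0 = (col k : ℕ)) ∧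
  ∀ i j, (supportGraph K).Adj i j → col i ≠ col j

end Machine

/-! ### Random Block Osborne -/

section Osborne

variable {n p : ℕ}

open Classical in
/-- Simultaneous Osborne updates of the coordinates of colour `l`:
`x_k ← x_k + (log c_k(A) - log r_k(A)) / 2` with `A = diag(e^x) K diag(e^{-x})`. -/
def blockUpdate (K : Matrix (Fin n) (Fin n) ℝ) (col : Fin n → Fin p) (l : Fin p)
    (x : Fin n → ℝ) : Fin n → ℝ := fun k =>
  if col k = l then
    x k + (Real.log (colSum (scaling K x) k) - Real.log (rowSum (scaling K x) k)) / 2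
  else x k

/-- The iterates of Block Osborne started at `0`, when block `ω t` is updated in step `t`. -/
def iterate (K : Matrix (Fin n) (Fin n) ℝ) (col : Fin n → Fin p) (ω : ℕ → Fin p) :
    ℕ → Fin n → ℝ
  | 0 => 0
  | t + 1 => blockUpdate K col (ω t) (iterate K col ω t)

/-- The number of block updates of Block Osborne: it stops as soon as the current scaling is
`ε`-balanced (`⊤` if this never happens). -/
def numUpdates (K : Matrix (Fin n) (Fin n) ℝ) (ε : ℝ) (col : Fin n → Fin p) (ω : ℕ → Fin p) :
    ℕ∞ :=
  ⨅ t ∈ {t : ℕ | IsEpsBalanced ε (scaling K (iterate K col ω t))}, (t : ℕ∞)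

open Classical in
/-- The work of one simultaneous update of the coordinates of colour `l`: one unit for choosing and
announcing `l`, one for each updated coordinate, and one for each nonzero entry
in the row and in the column of each updated coordinate. Up to a universal constant
factor this is the number of arithmetic operations, including those that keep the row sums, the
column sums, the total and the `ℓ₁` imbalance of the scaling up to date for the stopping test. -/
def blockWork (K : Matrix (Fin n) (Fin n) ℝ) (col : Fin n → Fin p) (l : Fin p) : ℕ :=
  1 + ∑ k, if col k = l then 1 + nnzAt K k else 0

/-- Rounds of the whole algorithm: `R` rounds of colouring, one round to compute the
row and column sums of `K`, and one round for each block update. -/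
def parRounds (K : Matrix (Fin n) (Fin n) ℝ) (ε : ℝ) (R : ℕ) (col : Fin n → Fin p)
    (ω : ℕ → Fin p) : ℝ≥0∞ :=
  R + 1 + ((numUpdates K ε col ω : ℕ∞) : ℝ≥0∞)

open Classical in
/-- Total work of the whole algorithm: `W` steps of colouring, `n + m` operations
to compute the row and column sums of `K`, and the work of all block updates. -/
def parWork (K : Matrix (Fin n) (Fin n) ℝ) (ε : ℝ) (W : ℕ) (col : Fin n → Fin p)
    (ω : ℕ → Fin p) : ℝ≥0∞ :=
  W + (n + nnz K) +
    ∑' t : ℕ, if (t : ℕ∞) < numUpdates K ε col ω then (blockWork K col (ω t) : ℝ≥0∞) else 0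

/-- The law of the block choices of Random Block Osborne: independent and uniform. -/
def blockLaw (p : ℕ) : Measure (ℕ → Fin p) :=
  Measure.infinitePi fun _ => uniformOn Set.univ

end Osborne

end ParBalance

end

open ParBalance

/-!
# Parallel Osborne balancing of uniformly sparse matrices

*Balancing.* Osborne's iteration descends the convex function `log (total (scaling K x))`, whose
gradient is the normalized difference of row sums and column sums. A colour class is an independent
set of the support graph, so the updates of one block do not interfere, and they remove at least
the mass `(√r_k - √c_k) ^ 2` for each updated `k` (`sum_sq_le_total_sub`). Averaged over the `p`
colours, the relative decrease is by Cauchy–Schwarz at least `e ^ 2 / (4 p)`, where `e` is the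
imbalance (`imbalance_sq_le_sum_gap_sub`). By convexity the suboptimality `g` is at most `e * R`
with `R = 2 d log κ`, because along an edge of the digraph the coordinates of a point of the
sublevel set drop by at most `log κ` (`gap_le_imbalance_mul`). While the scaling is not balanced,
`e > ε` as well, so `g` decreases on average by at least `(ε + g / R) ^ 2 / (16 p)`. The concave
function `V = (16 p R / ε) * g / (g + ε R)` of `g` turns this into a drop of at least `1` on average
per update, and it never exceeds a multiple of `(p / ε) * min (1 / ε) d * log κ`
(`isDrift_blockUpdate`). This one potential yields both branches of the minimum.

*Probability.* For a bounded nonincreasing potential with unit drift, the accumulated cost of the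
steps has an exponential moment of the order of its mean bound (`IsDrift.lintegral_exp_le`): the
exponential of the cost, tilted by the potential, is a supermartingale. Expectation and tails
follow, for the number of updates with cost `1` per step and for the work with the cost `blockWork`,
whose sum over all colours is at most `4 m`.

*Colouring.* Group the vertices by the leading bits of their identifiers. In each of `⌈log₂ n⌉`
phases, pairs of groups merge: the lower half keeps its colours; in the upper half the old
colour classes take turns, and each vertex picks a colour that is not used by its neighbours in the
merged group (`NetInv`). Each phase takes `Δ + 1` rounds, in exactly one of which a given
processor is awake, for `O(deg + 1)` steps (`exec_colouringCmd_phase`). This makes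
`O(Δ log n)` rounds and `O(m log n)` work (`exists_colouring`), which is within the bounds since
`n ≤ m ≤ κ`, `ε < 2` and `d ≥ 1`.
-/

noncomputable section

namespace ParBalance

/-! ### Exponential moments from expected drift -/

section Drift

variable {p : ℕ}

instance [NeZero p] : IsProbabilityMeasure (blockLaw p) := by
  unfold blockLaw
  have : IsProbabilityMeasure (uniformOn (Set.univ : Set (Fin p))) :=
    isProbabilityMeasure_uniformOn Set.finite_univ Set.univ_nonempty
  infer_instance

/-- A function of finitely many block choices factors through a finite discrete space. -/
lemma exists_factor_of_dependsOn [NeZero p] {β : Type*} {t : ℕ} {F : (ℕ → Fin p) → β}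
    (hF : DependsOn F (Set.Iio t)) :
    ∃ G : ((Finset.range t) → Fin p) → β, ∀ ω, F ω = G fun i => ω i := by
  refine ⟨fun z => F fun s => if h : s ∈ Finset.range t then z ⟨s, h⟩ else 0, fun ω => ?_⟩
  refine hF fun s hs => ?_
  simp [Set.mem_Iio.1 hs]

lemma measurable_of_dependsOn [NeZero p] {β : Type*} [MeasurableSpace β] {t : ℕ}
    {F : (ℕ → Fin p) → β} (hF : DependsOn F (Set.Iio t)) : Measurable F := by
  obtain ⟨G, hG⟩ := exists_factor_of_dependsOn hF
  rw [show F = fun ω => G fun i => ω i from funext hG]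
  exact (measurable_of_countable G).comp (by fun_prop)

lemma blockLaw_eval_eq [NeZero p] (t : ℕ) (l : Fin p) :
    blockLaw p {ω | ω t = l} = (p : ℝ≥0∞)⁻¹ := by
  have : IsProbabilityMeasure (uniformOn (Set.univ : Set (Fin p))) :=
    isProbabilityMeasure_uniformOn Set.finite_univ Set.univ_nonempty
  have h := Measure.infinitePi_map_eval
    (fun _ : ℕ => (uniformOn (Set.univ : Set (Fin p)))) t
  have h2 := congrArg (fun ν => ν {l}) h
  beta_reduce at h2
  rw [Measure.map_apply (measurable_pi_apply t) (measurableSet_singleton l),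
    uniformOn_univ] at h2
  simp only [Measure.count_singleton, Fintype.card_fin, one_div] at h2
  exact h2

/-- The block chosen in step `t` is uniform and independent of the earlier choices. -/
lemma lintegral_blockLaw_step [NeZero p] (t : ℕ) (F : Fin p → (ℕ → Fin p) → ℝ≥0∞)
    (hF : ∀ l, DependsOn (F l) (Set.Iio t)) :
    ∫⁻ ω, F (ω t) ω ∂blockLaw p = (p : ℝ≥0∞)⁻¹ * ∑ l, ∫⁻ ω, F l ω ∂blockLaw p := by
  have : IsProbabilityMeasure (uniformOn (Set.univ : Set (Fin p))) :=
    isProbabilityMeasure_uniformOn Set.finite_univ Set.univ_nonempty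
  have hind : ∀ l : Fin p, MeasurableSet {ω : ℕ → Fin p | ω t = l} := fun l =>
    (measurableSet_singleton l).preimage (measurable_pi_apply t)
  set J : Fin p → (ℕ → Fin p) → ℝ≥0∞ :=
    fun l => Set.indicator {ω : ℕ → Fin p | ω t = l} (1 : (ℕ → Fin p) → ℝ≥0∞) with hJ
  have h1 : ∀ ω : ℕ → Fin p, F (ω t) ω =
      ∑ l, (J l * F l) ω := by
    intro ω
    rw [Finset.sum_eq_single (ω t)]
    · simp [hJ]
    · intro l _ hl
      simp [hJ, hl.symm]
    · simp
  simp_rw [h1]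
  rw [lintegral_finsetSum, Finset.mul_sum]
  · refine Finset.sum_congr rfl fun l _ => ?_
    have hI : iIndepFun (fun (i : ℕ) (ω : ℕ → Fin p) => ω i) (blockLaw p) :=
      iIndepFun_infinitePi (P := fun _ : ℕ => uniformOn (Set.univ : Set (Fin p)))
        (X := fun _ x => x) fun _ => measurable_id
    have hI2 := hI.indepFun_finset {t} (Finset.range t) (by simp) fun i => measurable_pi_apply i
    obtain ⟨G, hG⟩ := exists_factor_of_dependsOn (hF l)
    have hI3 := hI2.comp
      (φ := fun z => ({z | z ⟨t, by simp⟩ = l} :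
        Set ((({t} : Finset ℕ)) → Fin p)).indicator (1 : ((({t} : Finset ℕ)) → Fin p) → ℝ≥0∞) z)
      (ψ := G) (measurable_of_countable _) (measurable_of_countable _)
    have hG' : F l = G ∘ fun (ω : ℕ → Fin p) (i : Finset.range t) => ω i := funext hG
    rw [lintegral_mul_eq_lintegral_mul_lintegral_of_indepFun
      (measurable_one.indicator (hind l)) (measurable_of_dependsOn (hF l))]
    · rw [lintegral_indicator_one (hind l), blockLaw_eval_eq]
    · rw [hG']
      exact hI3
  · intro l _
    exact (measurable_one.indicator (hind l)).mul (measurable_of_dependsOn (hF l))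

/-- A process whose average over the next block choice never exceeds its present value
has expectation at most its initial value. -/
lemma lintegral_le_of_supermartingale [NeZero p] (Z : ℕ → (ℕ → Fin p) → ℝ≥0∞)
    (hZ : ∀ t, DependsOn (Z t) (Set.Iio t)) {c : ℝ≥0∞} (h0 : ∀ ω, Z 0 ω ≤ c)
    (hstep : ∀ t ω, ∑ l, Z (t + 1) (Function.update ω t l) ≤ p * Z t ω) (t : ℕ) :
    ∫⁻ ω, Z t ω ∂blockLaw p ≤ c := by
  induction t with
  | zero => exact (lintegral_mono h0).trans (by simp)
  | succ t ih =>
    have hdep : ∀ l, DependsOn (fun ω => Z (t + 1) (Function.update ω t l)) (Set.Iio t) := by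
      intro l ω ω' h
      refine hZ (t + 1) fun s hs => ?_
      rcases eq_or_ne s t with rfl | hst
      · simp
      · have hs' : s < t + 1 := hs
        simp [Function.update_of_ne hst, h s (Set.mem_Iio.2 (by omega))]
    have h := lintegral_blockLaw_step t (fun l ω => Z (t + 1) (Function.update ω t l)) hdep
    simp only [Function.update_eq_self] at h
    rw [h, ← lintegral_finsetSum _ fun l _ => measurable_of_dependsOn (hdep l)]
    calc (p : ℝ≥0∞)⁻¹ * ∫⁻ ω, ∑ l, Z (t + 1) (Function.update ω t l) ∂blockLaw p
        ≤ (p : ℝ≥0∞)⁻¹ * ∫⁻ ω, p * Z t ω ∂blockLaw p := by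
          gcongr with ω
          exact hstep t ω
      _ = ∫⁻ ω, Z t ω ∂blockLaw p := by
          rw [lintegral_const_mul _ (measurable_of_dependsOn (hZ t)), ← mul_assoc,
            ENNReal.inv_mul_cancel (by simp [NeZero.ne]) (by simp), one_mul]
      _ ≤ c := ih

variable {X : Type*}

/-- A random walk driven by the block choices, together with a potential with negative drift:
`x` follows the maps `f` from `x₀`; within the invariant set `I` the potential `V` takes values in
`[0, M]` and never increases, and at states that are not `done` it drops by at least `1` on
average over the next block. -/
structure IsDrift (f : Fin p → X → X) (x : ℕ → (ℕ → Fin p) → X) (done I : X → Prop)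
    (V : X → ℝ) (M : ℝ) : Prop where
  start : ∃ x₀, I x₀ ∧ ∀ ω, x 0 ω = x₀
  next : ∀ t ω, x (t + 1) ω = f (ω t) (x t ω)
  inv : ∀ l z, I z → I (f l z)
  nonneg : ∀ z, I z → 0 ≤ V z
  le : ∀ z, I z → V z ≤ M
  anti : ∀ l z, I z → V (f l z) ≤ V z
  drift : ∀ z, I z → ¬ done z → ∑ l, V (f l z) ≤ p * (V z - 1)

/-- No state up to time `t` is `done`. -/
def Alive (x : ℕ → (ℕ → Fin p) → X) (done : X → Prop) (t : ℕ) (ω : ℕ → Fin p) : Prop :=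
  ∀ s ≤ t, ¬ done (x s ω)

open Classical in
/-- The cost `w (ω s)` of step `s`, paid as long as no state has been `done`. -/
def stepCost (x : ℕ → (ℕ → Fin p) → X) (done : X → Prop) (w : Fin p → ℕ) (s : ℕ)
    (ω : ℕ → Fin p) : ℕ :=
  if Alive x done s ω then w (ω s) else 0

/-- The total cost until a state is `done`. -/
def totalCost (x : ℕ → (ℕ → Fin p) → X) (done : X → Prop) (w : Fin p → ℕ)
    (ω : ℕ → Fin p) : ℝ≥0∞ :=
  ∑' s, (stepCost x done w s ω : ℝ≥0∞)

namespace IsDrift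

variable {f : Fin p → X → X} {x : ℕ → (ℕ → Fin p) → X} {done I : X → Prop} {V : X → ℝ} {M : ℝ}

lemma dependsOn (h : IsDrift f x done I V M) (t : ℕ) : DependsOn (x t) (Set.Iio t) := by
  induction t with
  | zero =>
    obtain ⟨x₀, -, h0⟩ := h.start
    intro ω ω' _
    rw [h0, h0]
  | succ t ih =>
    intro ω ω' hω
    have hlt : ∀ s < t + 1, ω s = ω' s := fun s hs => hω s hs
    rw [h.next, h.next, hlt t (by omega), ih fun s hs => hlt s (by
      have : s < t := hs
      omega)]

lemma inv_traj (h : IsDrift f x done I V M) (t : ℕ) (ω : ℕ → Fin p) : I (x t ω) := by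
  induction t with
  | zero => obtain ⟨x₀, hI, h0⟩ := h.start; rwa [h0]
  | succ t ih => rw [h.next]; exact h.inv _ _ ih

lemma alive_congr (h : IsDrift f x done I V M) (t : ℕ) {ω ω' : ℕ → Fin p}
    (hω : ∀ s < t, ω s = ω' s) : Alive x done t ω ↔ Alive x done t ω' := by
  unfold Alive
  refine forall₂_congr fun s hs => ?_
  rw [h.dependsOn s fun r hr => hω r (lt_of_lt_of_le hr hs)]

lemma stepCost_congr (h : IsDrift f x done I V M) (w : Fin p → ℕ) (s : ℕ) {ω ω' : ℕ → Fin p}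
    (hω : ∀ r < s + 1, ω r = ω' r) : stepCost x done w s ω = stepCost x done w s ω' := by
  unfold stepCost
  rw [hω s (Nat.lt_succ_self s)]
  have := h.alive_congr s (ω := ω) (ω' := ω') fun r hr => hω r (by omega)
  split_ifs <;> tauto

lemma sum_stepCost_congr (h : IsDrift f x done I V M) (w : Fin p → ℕ) (t : ℕ) {ω ω' : ℕ → Fin p}
    (hω : ∀ r < t, ω r = ω' r) :
    ∑ s ∈ Finset.range t, stepCost x done w s ω = ∑ s ∈ Finset.range t, stepCost x done w s ω' :=
  Finset.sum_congr rfl fun s hs => h.stepCost_congr w s fun r hr =>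
    hω r (by have := Finset.mem_range.1 hs; omega)

lemma measurable_stepCost [NeZero p] (h : IsDrift f x done I V M) (w : Fin p → ℕ) (s : ℕ) :
    Measurable fun ω => (stepCost x done w s ω : ℝ≥0∞) :=
  measurable_of_dependsOn (t := s + 1) fun _ _ hω => by
    rw [h.stepCost_congr w s fun r hr => hω r hr]

/-- A bound for the exponential moment of the cost of the first `t` steps. The exponential of the
cost, tilted by `exp (V / M)`, is a supermartingale: a drop `a ∈ [0, 1]` of `V / M` contributes a
factor `exp (-a) ≤ 1 - a / 2`, the cost `y = c * w` a factor `exp y ≤ 1 + 2 * y`, and while no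
state is `done` the average of `a` is at least `1 / M`, that of `y` at most `1 / (4 * M)`. -/
lemma lintegral_exp_le [NeZero p] (h : IsDrift f x done I V M) (hM : 0 < M) (w : Fin p → ℕ)
    {c : ℝ} (hc : 0 ≤ c) (hcw : ∀ l, c * w l ≤ 1) (hcM : 4 * M * c * (∑ l, (w l : ℝ)) ≤ p) (t : ℕ) :
    ∫⁻ ω, ENNReal.ofReal (Real.exp (c * ∑ s ∈ Finset.range t, (stepCost x done w s ω : ℝ)))
      ∂blockLaw p ≤ ENNReal.ofReal (Real.exp 1) := by
  set Z : ℕ → (ℕ → Fin p) → ℝ≥0∞ := fun t ω => ENNReal.ofReal (Real.exp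
    (V (x t ω) / M + c * ∑ s ∈ Finset.range t, (stepCost x done w s ω : ℝ))) with hZ
  refine (lintegral_mono (g := Z t) fun ω => ?_).trans
    (lintegral_le_of_supermartingale Z ?_ ?_ ?_ t)
  · refine ENNReal.ofReal_le_ofReal (Real.exp_le_exp.2 ?_)
    have := div_nonneg (h.nonneg _ (h.inv_traj t ω)) hM.le
    linarith
  · intro t ω ω' hω
    have h1 := h.sum_stepCost_congr w t (ω := ω) (ω' := ω') fun r hr => hω r hr
    have h2 : (∑ s ∈ Finset.range t, (stepCost x done w s ω : ℝ)) =
        ∑ s ∈ Finset.range t, (stepCost x done w s ω' : ℝ) := by exact_mod_cast h1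
    simp only [hZ, h.dependsOn t hω, h2]
  · intro ω
    refine ENNReal.ofReal_le_ofReal (Real.exp_le_exp.2 ?_)
    simpa using (div_le_one hM).2 (h.le _ (h.inv_traj 0 ω))
  · intro t ω
    have hI := h.inv_traj t ω
    set z := x t ω with hz
    set Q : ℝ := ∑ s ∈ Finset.range t, (stepCost x done w s ω : ℝ) with hS
    have hx : ∀ l, x (t + 1) (Function.update ω t l) = f l z := by
      intro l
      rw [h.next, Function.update_self, hz]
      congr 1
      refine h.dependsOn t fun s hs => Function.update_of_ne ?_ _ _
      exact (ne_of_lt hs)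
    have hsum : ∀ l, ∑ s ∈ Finset.range (t + 1),
        (stepCost x done w s (Function.update ω t l) : ℝ) =
        Q + stepCost x done w t (Function.update ω t l) := by
      intro l
      rw [Finset.sum_range_succ]
      rw [hS]
      have := h.sum_stepCost_congr w t (ω := Function.update ω t l) (ω' := ω) fun r hr =>
        Function.update_of_ne (ne_of_lt hr) _ _
      have h2 : (∑ s ∈ Finset.range t, (stepCost x done w s (Function.update ω t l) : ℝ)) =
        ∑ s ∈ Finset.range t, (stepCost x done w s ω : ℝ) := by exact_mod_cast this
      rw [h2]
    have hal : ∀ l, Alive x done t (Function.update ω t l) ↔ Alive x done t ω := fun l =>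
      h.alive_congr t fun r hr => Function.update_of_ne (ne_of_lt hr) _ _
    set y : Fin p → ℝ := fun l => c * stepCost x done w t (Function.update ω t l) with hy
    have hy0 : ∀ l, 0 ≤ y l := fun l => by positivity
    set a : Fin p → ℝ := fun l => (V z - V (f l z)) / M with ha
    have ha0 : ∀ l, 0 ≤ a l := fun l => div_nonneg (by linarith [h.anti l z hI]) hM.le
    have ha1 : ∀ l, a l ≤ 1 := fun l => (div_le_one hM).2 (by
      linarith [h.le z hI, h.nonneg _ (h.inv l z hI)])
    have hy1 : ∀ l, y l ≤ 1 := by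
      intro l
      simp only [hy, stepCost, hal, Function.update_self]
      split_ifs
      · exact hcw l
      · simp
    -- the factors by which the tilted moment is multiplied sum to at most `p`
    have hkey : ∑ l, Real.exp (-a l + y l) ≤ p := by
      have hb : ∀ l, Real.exp (-a l + y l) ≤ 1 - a l / 2 + 2 * y l := by
        intro l
        have e1 : Real.exp (-a l) ≤ 1 - a l / 2 := by
          have h2 : Real.exp (-a l) ≤ 1 / (1 + a l) := by
            rw [Real.exp_neg, inv_eq_one_div]
            exact one_div_le_one_div_of_le (by linarith [ha0 l])
              (by linarith [Real.add_one_le_exp (a l)])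
          refine h2.trans ?_
          rw [div_le_iff₀ (by linarith [ha0 l])]
          nlinarith [ha0 l, ha1 l]
        have e2 : Real.exp (y l) ≤ 1 + 2 * y l := by
          have := Real.abs_exp_sub_one_sub_id_le (x := y l) (by
            rw [abs_of_nonneg (hy0 l)]; exact hy1 l)
          have h3 := (abs_le.1 this).2
          nlinarith [hy0 l, hy1 l]
        rw [Real.exp_add]
        calc _ ≤ (1 - a l / 2) * (1 + 2 * y l) := by
              gcongr
              linarith [ha1 l]
          _ ≤ _ := by nlinarith [mul_nonneg (ha0 l) (hy0 l)]
      by_cases hA : Alive x done t ω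
      · have hnd : ¬ done z := hA t le_rfl
        have hd := h.drift z hI hnd
        have hyw : ∀ l, y l = c * w l := by
          intro l
          simp [hy, stepCost, hal, hA]
        have hsa : p / M ≤ ∑ l, a l := by
          simp only [ha]
          rw [← Finset.sum_div]
          gcongr
          rw [Finset.sum_sub_distrib]
          simp
          linarith
        have hsy : ∑ l, y l ≤ p / (4 * M) := by
          rw [le_div_iff₀ (by positivity)]
          simp only [hyw, ← Finset.mul_sum]
          linarith
        calc _ ≤ ∑ l, (1 - a l / 2 + 2 * y l) := Finset.sum_le_sum fun l _ => hb l
          _ = p - (∑ l, a l) / 2 + 2 * ∑ l, y l := by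
            rw [Finset.sum_add_distrib, Finset.sum_sub_distrib, Finset.mul_sum, Finset.sum_div]
            simp
          _ ≤ p - p / M / 2 + 2 * (p / (4 * M)) := by gcongr
          _ = p := by field_simp; ring
      · have hyw : ∀ l, y l = 0 := by
          intro l
          simp [hy, stepCost, hal, hA]
        calc _ ≤ ∑ l : Fin p, (1 : ℝ) := Finset.sum_le_sum fun l _ => by
              rw [hyw, add_zero]
              exact Real.exp_le_one_iff.2 (by linarith [ha0 l])
          _ = p := by simp
    have hterm : ∀ l, Z (t + 1) (Function.update ω t l) =
        ENNReal.ofReal (Real.exp (-a l + y l)) * Z t ω := by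
      intro l
      simp only [hZ, hx, hsum]
      rw [← ENNReal.ofReal_mul (Real.exp_nonneg _), ← Real.exp_add]
      congr 2
      simp only [ha, hy, ← hz, ← hS]
      field_simp
      ring
    simp_rw [hterm]
    rw [← Finset.sum_mul, ← ENNReal.ofReal_sum_of_nonneg fun l _ => Real.exp_nonneg _]
    gcongr
    exact (ENNReal.ofReal_le_ofReal hkey).trans (by simp)

lemma measurable_totalCost [NeZero p] (h : IsDrift f x done I V M) (w : Fin p → ℕ) :
    Measurable (totalCost x done w) :=
  Measurable.tsum fun s => h.measurable_stepCost w s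

/-- The expected total cost, from `c * y ≤ exp (c * y)`. -/
lemma lintegral_totalCost_le [NeZero p] (h : IsDrift f x done I V M) (hM : 0 < M) (w : Fin p → ℕ)
    {c : ℝ} (hc : 0 < c) (hcw : ∀ l, c * w l ≤ 1)
    (hcM : 4 * M * c * (∑ l, (w l : ℝ)) ≤ p) :
    ∫⁻ ω, totalCost x done w ω ∂blockLaw p ≤ ENNReal.ofReal (Real.exp 1 / c) := by
  unfold totalCost
  simp_rw [ENNReal.tsum_eq_iSup_nat]
  rw [lintegral_iSup]
  · refine iSup_le fun t => ?_
    calc ∫⁻ ω, ∑ s ∈ Finset.range t, (stepCost x done w s ω : ℝ≥0∞) ∂blockLaw p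
        ≤ ∫⁻ ω, ENNReal.ofReal (1 / c) * ENNReal.ofReal (Real.exp (c * ∑ s ∈ Finset.range t,
            (stepCost x done w s ω : ℝ))) ∂blockLaw p := by
          refine lintegral_mono fun ω => ?_
          simp only []
          rw [← ENNReal.ofReal_mul (by positivity)]
          have : (∑ s ∈ Finset.range t, (stepCost x done w s ω : ℝ≥0∞)) =
              ENNReal.ofReal (∑ s ∈ Finset.range t, (stepCost x done w s ω : ℝ)) := by
            rw [ENNReal.ofReal_sum_of_nonneg (by intros; positivity)]
            simp
          rw [this]
          refine ENNReal.ofReal_le_ofReal ?_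
          rw [one_div, ← div_eq_inv_mul, le_div_iff₀ hc]
          have := Real.add_one_le_exp (c * ∑ s ∈ Finset.range t, (stepCost x done w s ω : ℝ))
          linarith
      _ ≤ ENNReal.ofReal (1 / c) * ENNReal.ofReal (Real.exp 1) := by
          rw [lintegral_const_mul' _ _ ENNReal.ofReal_ne_top]
          gcongr
          exact h.lintegral_exp_le hM w hc.le hcw hcM t
      _ = ENNReal.ofReal (Real.exp 1 / c) := by
          rw [← ENNReal.ofReal_mul (by positivity)]
          congr 1
          ring
  · intro t
    exact Finset.measurable_sum _ fun s _ => h.measurable_stepCost w s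
  · intro t t' htt ω
    exact Finset.sum_le_sum_of_subset (Finset.range_mono htt)

/-- The exponential tail of the total cost, by Markov's inequality. -/
lemma measure_lt_totalCost_le [NeZero p] (h : IsDrift f x done I V M) (hM : 0 < M)
    (w : Fin p → ℕ) {c : ℝ} (hc : 0 < c) (hcw : ∀ l, c * w l ≤ 1)
    (hcM : 4 * M * c * (∑ l, (w l : ℝ)) ≤ p) {r : ℝ} (hr : 0 ≤ r) :
    blockLaw p {ω | ENNReal.ofReal r < totalCost x done w ω} ≤
      ENNReal.ofReal (Real.exp (1 - c * r)) := by
  have hset : {ω | ENNReal.ofReal r < totalCost x done w ω} =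
      ⋃ t, {ω | ENNReal.ofReal r < ∑ s ∈ Finset.range t, (stepCost x done w s ω : ℝ≥0∞)} := by
    ext ω
    simp [totalCost, ENNReal.tsum_eq_iSup_nat, lt_iSup_iff]
  rw [hset, Directed.measure_iUnion]
  · refine iSup_le fun t => ?_
    set E : (ℕ → Fin p) → ℝ≥0∞ := fun ω =>
      ENNReal.ofReal (Real.exp (c * ∑ s ∈ Finset.range t, (stepCost x done w s ω : ℝ))) with hE
    have hEm : Measurable E := measurable_of_dependsOn (t := t) fun ω ω' hω => by
      have h1 := h.sum_stepCost_congr w t (ω := ω) (ω' := ω') fun r hr => hω r hr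
      have h2 : (∑ s ∈ Finset.range t, (stepCost x done w s ω : ℝ)) =
        ∑ s ∈ Finset.range t, (stepCost x done w s ω' : ℝ) := by exact_mod_cast h1
      simp only [hE, h2]
    calc blockLaw p {ω | ENNReal.ofReal r < ∑ s ∈ Finset.range t, (stepCost x done w s ω : ℝ≥0∞)}
        ≤ blockLaw p {ω | ENNReal.ofReal (Real.exp (c * r)) ≤ E ω} := by
          refine measure_mono fun ω hω => ?_
          simp only [Set.mem_ofPred_eq] at hω ⊢
          refine ENNReal.ofReal_le_ofReal (Real.exp_le_exp.2 ?_)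
          have h3 : (∑ s ∈ Finset.range t, (stepCost x done w s ω : ℝ≥0∞)) =
              ENNReal.ofReal (∑ s ∈ Finset.range t, (stepCost x done w s ω : ℝ)) := by
            rw [ENNReal.ofReal_sum_of_nonneg (by intros; positivity)]
            simp
          rw [h3, ENNReal.ofReal_lt_ofReal_iff_of_nonneg hr] at hω
          gcongr
      _ ≤ (∫⁻ ω, E ω ∂blockLaw p) / ENNReal.ofReal (Real.exp (c * r)) :=
          meas_ge_le_lintegral_div hEm.aemeasurable
            (by simp [Real.exp_pos]) ENNReal.ofReal_ne_top
      _ ≤ ENNReal.ofReal (Real.exp 1) / ENNReal.ofReal (Real.exp (c * r)) := by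
          gcongr
          exact h.lintegral_exp_le hM w hc.le hcw hcM t
      _ = ENNReal.ofReal (Real.exp (1 - c * r)) := by
          rw [← ENNReal.ofReal_div_of_pos (Real.exp_pos _), Real.exp_sub]
  · refine Monotone.directed_le fun t t' htt ω hω => ?_
    rw [Set.mem_ofPred_eq] at hω ⊢
    exact lt_of_lt_of_le hω (Finset.sum_le_sum_of_subset (Finset.range_mono htt))

end IsDrift

end Drift

/-! ### Geometry of the scalings of an irreducible matrix -/

section Geometry

variable {n : ℕ} {K : Matrix (Fin n) (Fin n) ℝ}

lemma scaling_apply (K : Matrix (Fin n) (Fin n) ℝ) (x : Fin n → ℝ) (i j : Fin n) :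
    scaling K x i j = K i j * Real.exp (x i - x j) := by
  rw [scaling, Matrix.mul_diagonal, Matrix.diagonal_mul, sub_eq_add_neg, Real.exp_add]
  ring

lemma scaling_zero (K : Matrix (Fin n) (Fin n) ℝ) : scaling K 0 = K := by
  ext i j
  simp [scaling_apply]

lemma scaling_nonneg (hK : K.IsIrreducible) (x : Fin n → ℝ) (i j : Fin n) :
    0 ≤ scaling K x i j := by
  rw [scaling_apply]
  exact mul_nonneg (hK.nonneg i j) (Real.exp_nonneg _)

lemma entry_le_total {A : Matrix (Fin n) (Fin n) ℝ} (hA : ∀ i j, 0 ≤ A i j) (i j : Fin n) :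
    A i j ≤ total A := by
  unfold total
  exact (Finset.single_le_sum (f := fun j => A i j) (fun j _ => hA i j) (Finset.mem_univ j)).trans
    (Finset.single_le_sum (f := fun i => ∑ j, A i j)
      (fun i _ => Finset.sum_nonneg fun j _ => hA i j) (Finset.mem_univ i))

lemma total_eq_sum_rowSum (A : Matrix (Fin n) (Fin n) ℝ) : total A = ∑ k, rowSum A k := rfl

lemma total_eq_sum_colSum (A : Matrix (Fin n) (Fin n) ℝ) : total A = ∑ k, colSum A k :=
  Finset.sum_comm

lemma exists_row_pos (hn : 2 ≤ n) (hK : K.IsIrreducible) (i : Fin n) : ∃ j, 0 < K i j := by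
  have : Nontrivial (Fin n) := Fin.nontrivial_iff_two_le.2 hn
  exact hK.exists_pos i

lemma exists_col_pos (hn : 2 ≤ n) (hK : K.IsIrreducible) (j : Fin n) : ∃ i, 0 < K i j := by
  have : Nontrivial (Fin n) := Fin.nontrivial_iff_two_le.2 hn
  exact hK.transpose.exists_pos j

lemma rowSum_pos (hn : 2 ≤ n) (hK : K.IsIrreducible) (x : Fin n → ℝ) (k : Fin n) :
    0 < rowSum (scaling K x) k := by
  obtain ⟨j, hj⟩ := exists_row_pos hn hK k
  refine Finset.sum_pos' (fun j _ => scaling_nonneg hK x k j) ⟨j, Finset.mem_univ j, ?_⟩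
  rw [scaling_apply]
  positivity

lemma colSum_pos (hn : 2 ≤ n) (hK : K.IsIrreducible) (x : Fin n → ℝ) (k : Fin n) :
    0 < colSum (scaling K x) k := by
  obtain ⟨i, hi⟩ := exists_col_pos hn hK k
  refine Finset.sum_pos' (fun i _ => scaling_nonneg hK x i k) ⟨i, Finset.mem_univ i, ?_⟩
  rw [scaling_apply]
  positivity

lemma isLeast_minPosEntry (hn : 2 ≤ n) (hK : K.IsIrreducible) :
    IsLeast {a | ∃ i j, 0 < K i j ∧ a = K i j} (minPosEntry K) := by
  obtain ⟨j, hj⟩ := exists_row_pos hn hK ⟨0, by omega⟩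
  have hfin : {a | ∃ i j, 0 < K i j ∧ a = K i j}.Finite := by
    refine (Set.finite_range fun e : Fin n × Fin n => K e.1 e.2).subset ?_
    rintro a ⟨i, j, -, rfl⟩
    exact ⟨(i, j), rfl⟩
  have hne : {a | ∃ i j, 0 < K i j ∧ a = K i j}.Nonempty := ⟨_, _, _, hj, rfl⟩
  exact ⟨hne.csInf_mem hfin, fun a ha => csInf_le hfin.bddBelow ha⟩

lemma minPosEntry_pos (hn : 2 ≤ n) (hK : K.IsIrreducible) : 0 < minPosEntry K := by
  obtain ⟨i, j, h, h'⟩ := (isLeast_minPosEntry hn hK).1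
  rwa [h']

lemma minPosEntry_le (hn : 2 ≤ n) (hK : K.IsIrreducible) {i j : Fin n} (h : 0 < K i j) :
    minPosEntry K ≤ K i j :=
  (isLeast_minPosEntry hn hK).2 ⟨i, j, h, rfl⟩

/-- No scaling has total mass below the least positive entry of `K`: in the row of a largest
coordinate of `x` no entry decreases. -/
lemma minPosEntry_le_total (hn : 2 ≤ n) (hK : K.IsIrreducible) (x : Fin n → ℝ) :
    minPosEntry K ≤ total (scaling K x) := by
  have : Nonempty (Fin n) := ⟨⟨0, by omega⟩⟩
  obtain ⟨i, hi⟩ := Finite.exists_max x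
  obtain ⟨j, hj⟩ := exists_row_pos hn hK i
  refine (minPosEntry_le hn hK hj).trans (le_trans ?_ (entry_le_total (scaling_nonneg hK x) i j))
  rw [scaling_apply]
  exact le_mul_of_one_le_right hj.le (Real.one_le_exp (sub_nonneg.2 (hi j)))

lemma total_scaling_pos (hn : 2 ≤ n) (hK : K.IsIrreducible) (x : Fin n → ℝ) :
    0 < total (scaling K x) :=
  (minPosEntry_pos hn hK).trans_le (minPosEntry_le_total hn hK x)

lemma total_pos (hn : 2 ≤ n) (hK : K.IsIrreducible) : 0 < total K := by
  simpa [scaling_zero] using total_scaling_pos hn hK 0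

lemma le_nnz (hn : 2 ≤ n) (hK : K.IsIrreducible) : n ≤ nnz K := by
  choose f hf using exists_row_pos hn hK
  unfold nnz
  calc n = (Finset.univ : Finset (Fin n)).card := by simp
    _ ≤ _ := Finset.card_le_card_of_injOn (fun i => (i, f i))
      (fun i _ => by simpa using (hf i).ne') fun i _ j _ h => (Prod.ext_iff.1 h).1

lemma nnz_le_kappa (hn : 2 ≤ n) (hK : K.IsIrreducible) : (nnz K : ℝ) ≤ kappa K := by
  classical
  have htotal : total K = ∑ e : Fin n × Fin n, K e.1 e.2 :=
    (Fintype.sum_prod_type fun e : Fin n × Fin n => K e.1 e.2).symm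
  rw [kappa, le_div_iff₀ (minPosEntry_pos hn hK), htotal, nnz, ← nsmul_eq_mul,
    ← Finset.sum_const]
  refine (Finset.sum_le_sum fun e he => ?_).trans
    (Finset.sum_le_sum_of_subset_of_nonneg (Finset.filter_subset _ _) fun e _ _ =>
      hK.nonneg e.1 e.2)
  exact minPosEntry_le hn hK (lt_of_le_of_ne (hK.nonneg _ _) (Finset.mem_filter.1 he).2.symm)

lemma two_le_kappa (hn : 2 ≤ n) (hK : K.IsIrreducible) : 2 ≤ kappa K := by
  have h1 : (2 : ℝ) ≤ nnz K := by exact_mod_cast hn.trans (le_nnz hn hK)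
  exact h1.trans (nnz_le_kappa hn hK)

lemma log_kappa_pos (hn : 2 ≤ n) (hK : K.IsIrreducible) : 0 < Real.log (kappa K) :=
  Real.log_pos (by linarith [two_le_kappa hn hK])

lemma sub_le_log_kappa (hn : 2 ≤ n) (hK : K.IsIrreducible) {x : Fin n → ℝ}
    (hx : total (scaling K x) ≤ total K) {i j : Fin n} (h : 0 < K i j) :
    x i - x j ≤ Real.log (kappa K) := by
  rw [Real.le_log_iff_exp_le (by linarith [two_le_kappa hn hK]), kappa,
    le_div_iff₀ (minPosEntry_pos hn hK)]
  calc Real.exp (x i - x j) * minPosEntry K ≤ Real.exp (x i - x j) * K i j := by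
        gcongr
        exact minPosEntry_le hn hK h
    _ = scaling K x i j := by rw [scaling_apply, mul_comm]
    _ ≤ total (scaling K x) := entry_le_total (scaling_nonneg hK x) i j
    _ ≤ total K := hx

lemma exists_path_length_le (hK : K.IsIrreducible) (i j : Fin n) :
    ∃ p : @Quiver.Path (Fin n) K.toQuiver i j,
      @Quiver.Path.length _ K.toQuiver _ _ p ≤ dirDiam K := by
  obtain ⟨p, -⟩ := hK.connected i j
  have hne : {l | ∃ p : @Quiver.Path (Fin n) K.toQuiver i j,
    @Quiver.Path.length _ K.toQuiver _ _ p = l}.Nonempty := ⟨_, p, rfl⟩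
  obtain ⟨q, hq⟩ := Nat.sInf_mem hne
  refine ⟨q, hq.le.trans ?_⟩
  exact Finset.le_sup (f := fun e : Fin n × Fin n => dirDist K e.1 e.2) (Finset.mem_univ (i, j))

lemma one_le_dirDiam (hn : 2 ≤ n) (hK : K.IsIrreducible) : 1 ≤ dirDiam K := by
  obtain ⟨p, hp⟩ := exists_path_length_le hK ⟨0, by omega⟩ ⟨1, by omega⟩
  refine le_trans ?_ hp
  by_contra h
  have h0 : @Quiver.Path.length _ K.toQuiver _ _ p = 0 := by omega
  have := @Quiver.Path.eq_of_length_zero _ K.toQuiver _ _ p h0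
  simp at this

lemma sub_le_length_mul (hn : 2 ≤ n) (hK : K.IsIrreducible) {x : Fin n → ℝ}
    (hx : total (scaling K x) ≤ total K) {i j : Fin n} (p : @Quiver.Path (Fin n) K.toQuiver i j) :
    x i - x j ≤ @Quiver.Path.length _ K.toQuiver _ _ p * Real.log (kappa K) := by
  let := K.toQuiver
  induction p with
  | nil => simp
  | @cons b c q e ih =>
    have := sub_le_log_kappa hn hK hx e.down
    rw [Quiver.Path.length_cons]
    push_cast
    linarith

lemma sub_le_diam_mul (hn : 2 ≤ n) (hK : K.IsIrreducible) {x : Fin n → ℝ}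
    (hx : total (scaling K x) ≤ total K) (i j : Fin n) :
    x i - x j ≤ dirDiam K * Real.log (kappa K) := by
  obtain ⟨p, hp⟩ := exists_path_length_le hK i j
  refine (sub_le_length_mul hn hK hx p).trans ?_
  have := log_kappa_pos hn hK
  gcongr

/-- The normalized `ℓ₁` distance between row sums and column sums. -/
def imbalance (A : Matrix (Fin n) (Fin n) ℝ) : ℝ := (∑ k, |rowSum A k - colSum A k|) / total A

/-- Convexity of `x ↦ log (total (scaling K x))`, whose gradient is the normalized difference
of the row sums and the column sums. -/
lemma log_total_sub_le (hn : 2 ≤ n) (hK : K.IsIrreducible) (x y : Fin n → ℝ) :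
    Real.log (total (scaling K x)) - Real.log (total (scaling K y)) ≤
      (∑ k, (x k - y k) * (rowSum (scaling K x) k - colSum (scaling K x) k)) /
        total (scaling K x) := by
  set A := scaling K x with hA
  have hS := total_scaling_pos hn hK x
  have hS' := total_scaling_pos hn hK y
  rw [← hA] at hS
  set G := (∑ k, (x k - y k) * (rowSum A k - colSum A k)) / total A with hG
  have hGS : ∑ i, ∑ j, A i j * ((y i - x i) - (y j - x j)) = -G * total A := by
    rw [hG, neg_mul, div_mul_cancel₀ _ hS.ne']
    simp only [mul_sub, Finset.sum_sub_distrib]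
    have e1 : ∀ u : Fin n → ℝ, ∑ i, ∑ j, A i j * u i = ∑ k, u k * rowSum A k := fun u => by
      refine Finset.sum_congr rfl fun i _ => ?_
      rw [rowSum, ← Finset.sum_mul, mul_comm]
    have e2 : ∀ u : Fin n → ℝ, ∑ i, ∑ j, A i j * u j = ∑ k, u k * colSum A k := fun u => by
      rw [Finset.sum_comm]
      refine Finset.sum_congr rfl fun i _ => ?_
      rw [colSum, ← Finset.sum_mul, mul_comm]
    simp only [e1, e2, sub_mul, Finset.sum_sub_distrib]
    ring
  -- the tangent of `exp` at `-G`, averaged with the weights `A i j`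
  have hkey : Real.exp (-G) * total A ≤ total (scaling K y) := by
    have hterm : ∀ i j, A i j * (Real.exp (-G) * (1 + ((y i - x i) - (y j - x j)) + G)) ≤
        scaling K y i j := by
      intro i j
      have h1 : scaling K y i j = A i j * Real.exp ((y i - x i) - (y j - x j)) := by
        rw [hA, scaling_apply, scaling_apply, mul_assoc, ← Real.exp_add]
        congr 2
        ring
      rw [h1]
      refine mul_le_mul_of_nonneg_left ?_ (scaling_nonneg hK x i j)
      have h2 := Real.add_one_le_exp ((y i - x i) - (y j - x j) + G)
      calc Real.exp (-G) * (1 + ((y i - x i) - (y j - x j)) + G)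
          ≤ Real.exp (-G) * Real.exp ((y i - x i) - (y j - x j) + G) := by
            gcongr
            linarith
        _ = Real.exp ((y i - x i) - (y j - x j)) := by
            rw [← Real.exp_add]
            congr 1
            ring
    have hsum := Finset.sum_le_sum fun i (_ : i ∈ Finset.univ) =>
      Finset.sum_le_sum fun j (_ : j ∈ Finset.univ) => hterm i j
    have hl : ∑ i, ∑ j, A i j * (Real.exp (-G) * (1 + ((y i - x i) - (y j - x j)) + G)) =
        Real.exp (-G) * total A := by
      have : ∀ i j, A i j * (Real.exp (-G) * (1 + ((y i - x i) - (y j - x j)) + G)) =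
          Real.exp (-G) * (1 + G) * A i j +
            Real.exp (-G) * (A i j * ((y i - x i) - (y j - x j))) := fun i j => by ring
      simp only [this, Finset.sum_add_distrib, ← Finset.mul_sum, hGS]
      rw [show ∑ i, ∑ j, A i j = total A from rfl]
      ring
    rw [hl] at hsum
    exact hsum
  have := Real.log_le_log (by positivity) hkey
  rw [Real.log_mul (Real.exp_ne_zero _) hS.ne', Real.log_exp] at this
  linarith

/-- The suboptimality of the potential is at most the imbalance times the size of the sublevel
set. -/
lemma log_total_sub_le_imbalance (hn : 2 ≤ n) (hK : K.IsIrreducible) {x y : Fin n → ℝ}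
    (hx : total (scaling K x) ≤ total K) (hy : total (scaling K y) ≤ total K) :
    Real.log (total (scaling K x)) - Real.log (total (scaling K y)) ≤
      imbalance (scaling K x) * (2 * (dirDiam K * Real.log (kappa K))) := by
  refine (log_total_sub_le hn hK x y).trans ?_
  have hS := total_scaling_pos hn hK x
  rw [imbalance, div_mul_eq_mul_div]
  gcongr
  set A := scaling K x
  -- the differences sum to zero, so `x - y` may be shifted by a constant
  set o : Fin n := ⟨0, by omega⟩
  have hz : ∑ k, (rowSum A k - colSum A k) = 0 := by
    rw [Finset.sum_sub_distrib, ← total_eq_sum_rowSum, ← total_eq_sum_colSum, sub_self]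
  calc ∑ k, (x k - y k) * (rowSum A k - colSum A k)
      = ∑ k, ((x k - x o) + (y o - y k)) * (rowSum A k - colSum A k) +
          (x o - y o) * ∑ k, (rowSum A k - colSum A k) := by
        rw [Finset.mul_sum, ← Finset.sum_add_distrib]
        refine Finset.sum_congr rfl fun k _ => ?_
        ring
    _ = ∑ k, ((x k - x o) + (y o - y k)) * (rowSum A k - colSum A k) := by rw [hz]; ring
    _ ≤ ∑ k, |rowSum A k - colSum A k| * (2 * (dirDiam K * Real.log (kappa K))) := by
        refine Finset.sum_le_sum fun k _ => ?_
        refine (le_abs_self _).trans ?_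
        rw [abs_mul, mul_comm]
        gcongr
        rw [abs_le]
        constructor <;>
        linarith [sub_le_diam_mul hn hK hx k o, sub_le_diam_mul hn hK hx o k,
          sub_le_diam_mul hn hK hy k o, sub_le_diam_mul hn hK hy o k]
    _ = _ := by rw [Finset.sum_mul]

end Geometry

/-! ### Decrease of the total mass in a block update -/

section Descent

variable {n p : ℕ} {K : Matrix (Fin n) (Fin n) ℝ}

/-- Updating an independent set of coordinates removes at least the mass
`(√r_k - √c_k) ^ 2` for each of them; diagonal entries only help. -/
lemma sum_sq_le_total_sub (hn : 2 ≤ n) (hK : K.IsIrreducible) {col : Fin n → Fin p}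
    (hcol : ∀ i j, (supportGraph K).Adj i j → col i ≠ col j) (l : Fin p) (x : Fin n → ℝ) :
    ∑ k, (if col k = l then
      (√(rowSum (scaling K x) k) - √(colSum (scaling K x) k)) ^ 2 else 0) ≤
      total (scaling K x) - total (scaling K (blockUpdate K col l x)) := by
  classical
  set A := scaling K x with hA
  set u : Fin n → ℝ := fun k => if col k = l then
    (Real.log (colSum A k) - Real.log (rowSum A k)) / 2 else 0 with hu
  have hupd : ∀ k, blockUpdate K col l x k = x k + u k := by
    intro k
    simp only [blockUpdate, hu]
    split_ifs <;> simp [hA]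
  have hB : ∀ i j, scaling K (blockUpdate K col l x) i j = A i j * Real.exp (u i - u j) := by
    intro i j
    rw [hA, scaling_apply, scaling_apply, mul_assoc, ← Real.exp_add, hupd, hupd]
    congr 2
    ring
  have hterm : ∀ i j, A i j * (1 - Real.exp (u i)) + A i j * (1 - Real.exp (-u j)) ≤
      A i j - scaling K (blockUpdate K col l x) i j := by
    intro i j
    rw [hB]
    have hA0 : 0 ≤ A i j := scaling_nonneg hK x i j
    by_cases hi : col i = l
    · by_cases hj : col j = l
      · rcases eq_or_ne i j with rfl | hij
        · have h1 : 2 ≤ Real.exp (u i) + Real.exp (-u i) := by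
            have := Real.one_le_cosh (u i)
            rw [Real.cosh_eq] at this
            linarith
          rw [sub_self, Real.exp_zero]
          nlinarith
        · have hKij : K i j = 0 := by
            by_contra hne
            refine hcol i j ?_ (hi.trans hj.symm)
            rw [supportGraph, SimpleGraph.fromRel_adj]
            exact ⟨hij, Or.inl (lt_of_le_of_ne (hK.nonneg i j) (Ne.symm hne))⟩
          have : A i j = 0 := by rw [hA, scaling_apply, hKij, zero_mul]
          simp [this]
      · have : u j = 0 := by simp [hu, hj]
        simp only [this, sub_zero, neg_zero, Real.exp_zero]
        linarith
    · have : u i = 0 := by simp [hu, hi]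
      simp only [this, zero_sub, Real.exp_zero]
      linarith
  have hsum : ∑ i, ∑ j, (A i j * (1 - Real.exp (u i)) + A i j * (1 - Real.exp (-u j))) ≤
      total A - total (scaling K (blockUpdate K col l x)) := by
    simp only [total]
    rw [← Finset.sum_sub_distrib]
    refine Finset.sum_le_sum fun i _ => ?_
    rw [← Finset.sum_sub_distrib]
    exact Finset.sum_le_sum fun j _ => hterm i j
  refine le_trans (le_of_eq ?_) hsum
  have e2 : ∑ i, ∑ j, A i j * (1 - Real.exp (-u j)) =
      ∑ k, colSum A k * (1 - Real.exp (-u k)) := by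
    rw [Finset.sum_comm]
    simp only [colSum, Finset.sum_mul]
  have e1 : ∑ i, ∑ j, A i j * (1 - Real.exp (u i)) =
      ∑ k, rowSum A k * (1 - Real.exp (u k)) := by
    simp only [rowSum, Finset.sum_mul]
  simp only [Finset.sum_add_distrib, e1, e2]
  rw [← Finset.sum_add_distrib]
  refine Finset.sum_congr rfl fun k _ => ?_
  split_ifs with hk
  · have hr := rowSum_pos hn hK x k
    have hc := colSum_pos hn hK x k
    rw [← hA] at hr hc
    have hr' := Real.sqrt_pos.2 hr
    have hc' := Real.sqrt_pos.2 hc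
    have huk : Real.exp (u k) = √(colSum A k) / √(rowSum A k) := by
      simp only [hu, hk, if_true]
      rw [sub_div, Real.exp_sub, ← Real.log_sqrt hc.le, ← Real.log_sqrt hr.le,
        Real.exp_log hr', Real.exp_log hc']
    have huk' : Real.exp (-u k) = √(rowSum A k) / √(colSum A k) := by
      rw [Real.exp_neg, huk, inv_div]
    rw [huk, huk']
    have e3 := Real.sq_sqrt hr.le
    have e4 := Real.sq_sqrt hc.le
    generalize √(rowSum A k) = a at *
    generalize √(colSum A k) = b at *
    rw [← e3, ← e4]
    field_simp
    ring
  · simp [hu, hk]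

lemma total_blockUpdate_le (hn : 2 ≤ n) (hK : K.IsIrreducible) {col : Fin n → Fin p}
    (hcol : ∀ i j, (supportGraph K).Adj i j → col i ≠ col j) (l : Fin p) (x : Fin n → ℝ) :
    total (scaling K (blockUpdate K col l x)) ≤ total (scaling K x) := by
  have h := sum_sq_le_total_sub hn hK hcol l x
  have : 0 ≤ ∑ k, (if col k = l then
      (√(rowSum (scaling K x) k) - √(colSum (scaling K x) k)) ^ 2 else 0) :=
    Finset.sum_nonneg fun k _ => by positivity
  linarith

/-- The Hellinger-type distance of row and column sums dominates the square of the imbalance,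
by the Cauchy–Schwarz inequality. -/
lemma imbalance_sq_le (hn : 2 ≤ n) (hK : K.IsIrreducible) (x : Fin n → ℝ) :
    imbalance (scaling K x) ^ 2 / 4 ≤
      (∑ k, (√(rowSum (scaling K x) k) - √(colSum (scaling K x) k)) ^ 2) /
        total (scaling K x) := by
  have hS := total_scaling_pos hn hK x
  set A := scaling K x with hA
  have hr : ∀ k, 0 < rowSum A k := rowSum_pos hn hK x
  have hc : ∀ k, 0 < colSum A k := colSum_pos hn hK x
  have h1 : ∀ k, |rowSum A k - colSum A k| =
      |√(rowSum A k) - √(colSum A k)| * (√(rowSum A k) + √(colSum A k)) := by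
    intro k
    rw [← abs_of_pos (add_pos (Real.sqrt_pos.2 (hr k)) (Real.sqrt_pos.2 (hc k))), ← abs_mul]
    congr 1
    have e1 := Real.sq_sqrt (hr k).le
    have e2 := Real.sq_sqrt (hc k).le
    linear_combination e2 - e1
  have hCS := Finset.sum_mul_sq_le_sq_mul_sq Finset.univ
    (fun k => |√(rowSum A k) - √(colSum A k)|) (fun k => √(rowSum A k) + √(colSum A k))
  simp only [← h1, sq_abs] at hCS
  have h2 : ∑ k, (√(rowSum A k) + √(colSum A k)) ^ 2 ≤ 4 * total A := by
    calc _ ≤ ∑ k, (2 * rowSum A k + 2 * colSum A k) := by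
          refine Finset.sum_le_sum fun k _ => ?_
          have e1 := Real.sq_sqrt (hr k).le
          have e2 := Real.sq_sqrt (hc k).le
          nlinarith [sq_nonneg (√(rowSum A k) - √(colSum A k))]
      _ = 4 * total A := by
          rw [Finset.sum_add_distrib, ← Finset.mul_sum, ← Finset.mul_sum, ← total_eq_sum_rowSum,
            ← total_eq_sum_colSum]
          ring
  set H := ∑ k, (√(rowSum A k) - √(colSum A k)) ^ 2 with hH
  have hH0 : 0 ≤ H := Finset.sum_nonneg fun k _ => sq_nonneg _
  rw [imbalance, div_pow, div_div, div_le_div_iff₀ (by positivity) hS]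
  nlinarith [mul_le_mul_of_nonneg_left h2 hH0]

end Descent

/-! ### The potential and its drift -/

section Potential

variable {n p : ℕ} {K : Matrix (Fin n) (Fin n) ℝ}

/-- The suboptimality of `x` for the logarithm of the total mass. The infimum is attained for
irreducible `K`, but this is not needed. -/
def gap (K : Matrix (Fin n) (Fin n) ℝ) (x : Fin n → ℝ) : ℝ :=
  Real.log (total (scaling K x)) - ⨅ y, Real.log (total (scaling K y))

lemma bddBelow_log_total (hn : 2 ≤ n) (hK : K.IsIrreducible) :
    BddBelow (Set.range fun y => Real.log (total (scaling K y))) := by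
  refine ⟨Real.log (minPosEntry K), ?_⟩
  rintro _ ⟨y, rfl⟩
  exact Real.log_le_log (minPosEntry_pos hn hK) (minPosEntry_le_total hn hK y)

lemma gap_nonneg (hn : 2 ≤ n) (hK : K.IsIrreducible) (x : Fin n → ℝ) : 0 ≤ gap K x :=
  sub_nonneg.2 (ciInf_le (bddBelow_log_total hn hK) x)

lemma gap_le_log_kappa (hn : 2 ≤ n) (hK : K.IsIrreducible) {x : Fin n → ℝ}
    (hx : total (scaling K x) ≤ total K) : gap K x ≤ Real.log (kappa K) := by
  rw [kappa, Real.log_div (total_pos hn hK).ne' (minPosEntry_pos hn hK).ne', gap]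
  have h1 := Real.log_le_log (total_scaling_pos hn hK x) hx
  have h2 : Real.log (minPosEntry K) ≤ ⨅ y, Real.log (total (scaling K y)) :=
    le_ciInf fun y => Real.log_le_log (minPosEntry_pos hn hK) (minPosEntry_le_total hn hK y)
  linarith

lemma gap_le_imbalance_mul (hn : 2 ≤ n) (hK : K.IsIrreducible) {x : Fin n → ℝ}
    (hx : total (scaling K x) ≤ total K) :
    gap K x ≤ imbalance (scaling K x) * (2 * (dirDiam K * Real.log (kappa K))) := by
  have himb : 0 ≤ imbalance (scaling K x) :=
    div_nonneg (Finset.sum_nonneg fun _ _ => abs_nonneg _) (total_scaling_pos hn hK x).le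
  have hlog := log_kappa_pos hn hK
  rw [gap, sub_le_comm]
  refine le_ciInf fun y => ?_
  by_cases hy : total (scaling K y) ≤ total K
  · linarith [log_total_sub_le_imbalance hn hK hx hy]
  · have := Real.log_le_log (total_scaling_pos hn hK x) (hx.trans (not_le.1 hy).le)
    have h2 : 0 ≤ imbalance (scaling K x) * (2 * (dirDiam K * Real.log (kappa K))) := by
      positivity
    linarith

lemma gap_blockUpdate_le (hn : 2 ≤ n) (hK : K.IsIrreducible) {col : Fin n → Fin p}
    (hcol : ∀ i j, (supportGraph K).Adj i j → col i ≠ col j) (l : Fin p) (x : Fin n → ℝ) :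
    gap K (blockUpdate K col l x) ≤ gap K x :=
  sub_le_sub_right (Real.log_le_log (total_scaling_pos hn hK _)
    (total_blockUpdate_le hn hK hcol l x)) _

/-- The decrease of the gap, summed over all blocks. -/
lemma imbalance_sq_le_sum_gap_sub (hn : 2 ≤ n) (hK : K.IsIrreducible) {col : Fin n → Fin p}
    (hcol : ∀ i j, (supportGraph K).Adj i j → col i ≠ col j) (x : Fin n → ℝ) :
    imbalance (scaling K x) ^ 2 / 4 ≤ ∑ l, (gap K x - gap K (blockUpdate K col l x)) := by
  classical
  have hS := total_scaling_pos hn hK x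
  refine (imbalance_sq_le hn hK x).trans ?_
  have h1 : ∀ l, (∑ k, (if col k = l then
      (√(rowSum (scaling K x) k) - √(colSum (scaling K x) k)) ^ 2 else 0)) /
        total (scaling K x) ≤ gap K x - gap K (blockUpdate K col l x) := by
    intro l
    have hS' := total_scaling_pos hn hK (blockUpdate K col l x)
    have h2 := Real.one_sub_inv_le_log_of_pos (div_pos hS hS')
    rw [Real.log_div hS.ne' hS'.ne', inv_div] at h2
    rw [gap, gap, sub_sub_sub_cancel_right]
    refine le_trans ?_ h2
    rw [one_sub_div hS.ne']
    gcongr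
    exact sum_sq_le_total_sub hn hK hcol l x
  refine le_trans (le_of_eq ?_) (Finset.sum_le_sum fun l _ => h1 l)
  rw [← Finset.sum_div, Finset.sum_comm]
  simp

/-- The potential: a bounded concave function of the gap `g`, adapted to the decrease
`max(ε, g / R) ^ 2 / (4 p)` that the gap has on average. -/
def potential (K : Matrix (Fin n) (Fin n) ℝ) (p : ℕ) (ε R : ℝ) (x : Fin n → ℝ) : ℝ :=
  16 * p * R / ε * (gap K x / (gap K x + ε * R))

lemma isDrift_blockUpdate [NeZero p] (hn : 2 ≤ n) (hK : K.IsIrreducible) {col : Fin n → Fin p}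
    (hcol : ∀ i j, (supportGraph K).Adj i j → col i ≠ col j) {ε : ℝ} (hε : 0 < ε) :
    IsDrift (blockUpdate K col) (fun t ω => iterate K col ω t)
      (fun x => IsEpsBalanced ε (scaling K x)) (fun x => total (scaling K x) ≤ total K)
      (potential K p ε (2 * (dirDiam K * Real.log (kappa K))))
      (32 * p * (1 / ε * min (1 / ε) (dirDiam K) * Real.log (kappa K))) := by
  have hlog := log_kappa_pos hn hK
  have hd : (1 : ℝ) ≤ dirDiam K := by exact_mod_cast one_le_dirDiam hn hK
  have hp : (0 : ℝ) < p := by exact_mod_cast NeZero.pos p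
  set R : ℝ := 2 * (dirDiam K * Real.log (kappa K)) with hR
  have hR0 : 0 < R := by positivity
  have hεR : 0 < ε * R := by positivity
  -- the slope of the concave function of the gap at its right end point
  have hslope : ∀ g g' : ℝ, 0 ≤ g' → g' ≤ g →
      16 * p * R / ε * ((ε * R) * (g - g') / (g + ε * R) ^ 2) ≤
        16 * p * R / ε * (g / (g + ε * R)) - 16 * p * R / ε * (g' / (g' + ε * R)) := by
    intro g g' h0 h1
    rw [← mul_sub]
    have hg : 0 ≤ g := h0.trans h1
    have : g / (g + ε * R) - g' / (g' + ε * R) =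
        (ε * R) * (g - g') / ((g + ε * R) * (g' + ε * R)) := by
      have e1 : g + ε * R ≠ 0 := by positivity
      have e2 : g' + ε * R ≠ 0 := by positivity
      field_simp
      ring
    rw [this, sq]
    have : 0 ≤ g - g' := by linarith
    gcongr
  refine ⟨⟨0, by simp [scaling_zero], fun ω => rfl⟩, fun t ω => rfl, ?_, ?_, ?_, ?_, ?_⟩
  · exact fun l z hz => (total_blockUpdate_le hn hK hcol l z).trans hz
  · intro z _
    have := gap_nonneg hn hK z
    unfold potential
    positivity
  · intro z hz
    have h0 := gap_nonneg hn hK z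
    have h1 := gap_le_log_kappa hn hK hz
    rcases le_total (1 / ε) (dirDiam K : ℝ) with h | h
    · rw [min_eq_left h]
      calc potential K p ε R z ≤ 16 * p * R / ε * (Real.log (kappa K) / (ε * R)) := by
            unfold potential
            gcongr
            linarith
        _ = 16 * p * (1 / ε * (1 / ε) * Real.log (kappa K)) := by
            field_simp
        _ ≤ 32 * p * (1 / ε * (1 / ε) * Real.log (kappa K)) := by
            gcongr
            norm_num
    · rw [min_eq_right h]
      calc potential K p ε R z ≤ 16 * p * R / ε * 1 := by
            unfold potential
            gcongr
            rw [div_le_one (by positivity)]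
            linarith
        _ = 32 * p * (1 / ε * dirDiam K * Real.log (kappa K)) := by
            rw [hR]
            ring
  · intro l z _
    have h0 := gap_nonneg hn hK (blockUpdate K col l z)
    have h1 := gap_blockUpdate_le hn hK hcol l z
    have h2 := hslope _ _ h0 h1
    have h3 : 0 ≤ gap K z - gap K (blockUpdate K col l z) := by linarith
    have h4 : 0 ≤ 16 * p * R / ε * ((ε * R) * (gap K z - gap K (blockUpdate K col l z)) /
      (gap K z + ε * R) ^ 2) := by positivity
    unfold potential
    linarith
  · intro z hz hnd
    have hg := gap_nonneg hn hK z
    have he : ε < imbalance (scaling K z) := not_le.1 hnd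
    have hgi := gap_le_imbalance_mul hn hK hz
    rw [← hR] at hgi
    have hdec := imbalance_sq_le_sum_gap_sub hn hK hcol z
    set e := imbalance (scaling K z)
    set g := gap K z
    have hsum : ∑ l, 16 * p * R / ε * ((ε * R) * (g - gap K (blockUpdate K col l z)) /
        (g + ε * R) ^ 2) ≤ ∑ l, (potential K p ε R z -
          potential K p ε R (blockUpdate K col l z)) :=
      Finset.sum_le_sum fun l _ => hslope _ _ (gap_nonneg hn hK _)
        (gap_blockUpdate_le hn hK hcol l z)
    rw [← Finset.mul_sum, ← Finset.sum_div, ← Finset.mul_sum] at hsum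
    simp only [Finset.sum_sub_distrib, Finset.sum_const, Finset.card_univ, Fintype.card_fin, nsmul_eq_mul] at hsum
    have hpos : 0 < g + ε * R := by positivity
    have hlow : (p : ℝ) ≤ 16 * p * R / ε * ((ε * R) *
        (∑ l, (g - gap K (blockUpdate K col l z))) / (g + ε * R) ^ 2) := by
      have h1 : (g + ε * R) ^ 2 ≤ 4 * R ^ 2 * e ^ 2 := by
        have : g + ε * R ≤ 2 * R * e := by nlinarith
        calc (g + ε * R) ^ 2 ≤ (2 * R * e) ^ 2 := by gcongr
          _ = _ := by ring
      have h2 : (g + ε * R) ^ 2 ≤ 16 * R ^ 2 * ∑ l, (g - gap K (blockUpdate K col l z)) := by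
        nlinarith [sq_nonneg R, mul_le_mul_of_nonneg_left hdec (sq_nonneg R)]
      have h3 : 16 * p * R / ε * ((ε * R) *
        (∑ l, (g - gap K (blockUpdate K col l z))) / (g + ε * R) ^ 2) =
          p * ((16 * R ^ 2 * ∑ l, (g - gap K (blockUpdate K col l z))) / (g + ε * R) ^ 2) := by
        field_simp
      rw [h3]
      refine le_mul_of_one_le_right hp.le ?_
      rw [one_le_div (by positivity)]
      exact h2
    simp only [Finset.sum_sub_distrib, Finset.sum_const, Finset.card_univ, Fintype.card_fin,
      nsmul_eq_mul] at hlow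
    linarith

end Potential

/-! ### The colouring program -/

section Program

/-- Marks the colour of one neighbour as used, if the neighbour lies in the same group. Cell 12
is the number of the neighbour, cell 17 the own group, cell 19 the size of the groups; the mark of
colour `c` is the present round number (cell 6), written to cell `32 + c`. Writing to cell 22
serves as a no-op. -/
def markCmd : Cmd :=
  .seq (.recv 13 12) <| .seq (.mod 14 13 2) <| .seq (.div 15 13 2) <| .seq (.div 14 14 19) <|
  .seq (.ifLt 14 17 (.set 22 0) (.ifLt 17 14 (.set 22 0) (.seq (.add 16 18 15) (.store 16 6)))) <|
  .add 12 12 11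

/-- Copies the colour in cell 12 to cell 21 if it is not marked with the present round number,
and passes on to the next colour. -/
def scanCmd : Cmd :=
  .seq (.add 16 18 12) <| .seq (.load 13 16) <|
  .seq (.ifLt 13 6 (.add 21 12 10) (.set 22 0)) <| .add 12 12 11

/-- Chooses a colour that no neighbour in the same group has. -/
def recolourCmd : Cmd :=
  .seq (.set 12 0) <| .seq (.loop 5 markCmd) <| .seq (.set 12 0) <| .seq (.add 22 5 11) <|
  .seq (.loop 22 scanCmd) <| .add 8 21 10

/-- One phase: the vertices of the upper half of each group of the new size choose a new colour. -/
def phaseCmd : Cmd :=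
  .seq (.add 19 7 7) <| .seq (.div 17 4 19) <| .seq (.div 20 4 7) <| .seq (.set 22 2) <|
  .seq (.mod 20 20 22) <| .seq (.sub 1 1 8) <|
  .seq (.ifLt 10 20 recolourCmd (.set 22 0)) <|
  .seq (.add 1 1 9) <| .seq (.add 1 1 8) <| .seq (.add 7 19 10) <| .seq (.mul 0 8 2) <|
  .add 0 0 4

/-- The start: all vertices have colour `0` and form groups of their own. -/
def initCmd : Cmd :=
  .seq (.set 7 1) <| .seq (.set 11 1) <| .seq (.set 18 32) <| .seq (.add 9 3 11) <|
  .seq (.add 0 10 4) <| .set 1 1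

/-- The end: the colour is published and the processor never wakes up again. -/
def finishCmd : Cmd := .seq (.add 0 8 10) <| .set 1 0

/-- The distributed colouring program. Vertices are grouped by the leading bits of their
identifiers, and in each phase two groups are merged: the vertices of the lower half keep
their colours, and those of the upper half choose new ones, one old colour class after
the other. Cell 7 holds the size of the groups, cell 8 the colour; until the end the public word is
`colour * n + identifier`. -/
def colouringCmd : Cmd := .ifLt 10 6 (.ifLt 7 2 phaseCmd finishCmd) initCmd

lemma exec_seq (nb : ℕ → ℕ) (c d : Cmd) (s : (ℕ → ℕ) × ℕ) :
    exec nb (.seq c d) s = exec nb d (exec nb c s) := by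
  rw [exec]

lemma exec_ifLt_of_lt (nb : ℕ → ℕ) {a b : ℕ} (c d : Cmd) {s : (ℕ → ℕ) × ℕ} (h : s.1 a < s.1 b) :
    exec nb (.ifLt a b c d) s = exec nb c (s.1, s.2 + 1) := by
  rw [exec, if_pos h]

/-- Invariant rule for loops. -/
lemma exec_loop_inv (nb : ℕ → ℕ) (a : ℕ) (c : Cmd) (s : (ℕ → ℕ) × ℕ) (Inv : ℕ → (ℕ → ℕ) → Prop)
    (cost : ℕ) (h0 : Inv 0 s.1)
    (hstep : ∀ i m st, i < s.1 a → Inv i m →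
      Inv (i + 1) (exec nb c (m, st)).1 ∧ (exec nb c (m, st)).2 ≤ st + cost) :
    Inv (s.1 a) (exec nb (.loop a c) s).1 ∧
      (exec nb (.loop a c) s).2 ≤ s.2 + 1 + s.1 a * (cost + 1) := by
  rw [exec]
  have key : ∀ i ≤ s.1 a,
      Inv i ((fun u => exec nb c (u.1, u.2 + 1))^[i] (s.1, s.2 + 1)).1 ∧
      ((fun u => exec nb c (u.1, u.2 + 1))^[i] (s.1, s.2 + 1)).2 ≤
        s.2 + 1 + i * (cost + 1) := by
    intro i
    induction i with
    | zero => intro _; exact ⟨h0, by simp⟩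
    | succ i ih =>
      intro hi
      obtain ⟨h1, h2⟩ := ih (by omega)
      rw [Function.iterate_succ_apply']
      obtain ⟨h3, h4⟩ := hstep i _ (((fun u => exec nb c (u.1, u.2 + 1))^[i]
        (s.1, s.2 + 1)).2 + 1) (by omega) h1
      refine ⟨h3, h4.trans ?_⟩
      rw [add_mul]
      omega
  exact key _ le_rfl

/-- The registers that the loops of the program do not change. -/
def IsKept (a : ℕ) : Prop := a < 12 ∨ 17 ≤ a ∧ a < 20

lemma exec_markCmd (nb : ℕ → ℕ) (m : ℕ → ℕ) (st : ℕ) (h18 : m 18 = 32) (h11 : m 11 = 1) :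
    let s := exec nb markCmd (m, st)
    (∀ a, IsKept a → s.1 a = m a) ∧ s.1 12 = m 12 + 1 ∧
      (∀ a, 32 ≤ a → s.1 a = if nb (m 12) % m 2 / m 19 = m 17 ∧ a = 32 + nb (m 12) / m 2
        then m 6 else m a) ∧ s.2 ≤ st + 9 := by
  intro s
  simp only [s, markCmd, exec]
  simp only [Function.update_self, Function.update_apply, Nat.reduceEqDiff, if_false, h18,
    IsKept]
  split_ifs with h1 h2
  all_goals refine ⟨fun a ha => ?_, ?_, fun a ha => ?_, ?_⟩
  all_goals simp only [Function.update_apply, h18, h11] at *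
  all_goals grind

lemma exec_scanCmd (nb : ℕ → ℕ) (m : ℕ → ℕ) (st : ℕ) (h18 : m 18 = 32) (h11 : m 11 = 1)
    (h10 : m 10 = 0) :
    let s := exec nb scanCmd (m, st)
    (∀ a, IsKept a → s.1 a = m a) ∧ s.1 12 = m 12 + 1 ∧ (∀ a, 32 ≤ a → s.1 a = m a) ∧
      s.1 21 = (if m (32 + m 12) < m 6 then m 12 else m 21) ∧ s.2 ≤ st + 5 := by
  intro s
  simp only [s, scanCmd, exec]
  simp only [Function.update_self, Function.update_apply, Nat.reduceEqDiff, if_false, h18,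
    IsKept]
  split_ifs with h1 h2
  all_goals refine ⟨fun a ha => ?_, ?_, fun a ha => ?_, ?_, ?_⟩
  all_goals simp only [Function.update_apply, h18, h11, h10] at *
  all_goals grind

lemma exec_recolourCmd (nb : ℕ → ℕ) (m : ℕ → ℕ) (st : ℕ) (h18 : m 18 = 32) (h11 : m 11 = 1)
    (h10 : m 10 = 0) (hmark : ∀ a, 32 ≤ a → m a < m 6) :
    let s := exec nb recolourCmd (m, st)
    (∀ a, IsKept a → a ≠ 8 → s.1 a = m a) ∧ s.1 8 ≤ m 5 ∧
      (∀ i < m 5, nb i % m 2 / m 19 = m 17 → nb i / m 2 ≠ s.1 8) ∧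
      (∀ a, 32 ≤ a → s.1 a ≤ m 6) ∧ s.2 ≤ st + 16 * (m 5 + 1) := by
  intro s
  simp only [s, recolourCmd, exec_seq]
  -- the marks after some neighbours have been read
  set Inv₁ : ℕ → (ℕ → ℕ) → Prop := fun i m' => (∀ a, IsKept a → m' a = m a) ∧ m' 12 = i ∧
    ∀ a, 32 ≤ a → m' a ≤ m 6 ∧
      (m' a = m 6 ↔ ∃ i' < i, nb i' % m 2 / m 19 = m 17 ∧ a = 32 + nb i' / m 2) with hInv₁
  have hkept : ∀ a, IsKept a → a ≠ 12 := fun a ha h => by simp [IsKept, h] at ha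
  have hloop₁ := exec_loop_inv nb 5 markCmd (exec nb (.set 12 0) (m, st)) Inv₁ 9
    ⟨fun a ha => by simp [exec, Function.update_of_ne (hkept a ha)], by simp [exec],
      fun a ha => by
        have := hmark a ha
        have ha' : a ≠ 12 := by omega
        simp only [exec, Function.update_of_ne ha']
        refine ⟨this.le, iff_of_false this.ne ?_⟩
        simp⟩ (by
    rintro i m' st' - ⟨hk, h12, hm⟩
    obtain ⟨e1, e2, e3, e4⟩ := exec_markCmd nb m' st' ((hk 18 (by simp [IsKept])).trans h18)
      ((hk 11 (by simp [IsKept])).trans h11)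
    refine ⟨⟨fun a ha => (e1 a ha).trans (hk a ha), by rw [e2, h12], fun a ha => ?_⟩, e4⟩
    rw [e3 a ha, h12, hk 2 (by simp [IsKept]), hk 19 (by simp [IsKept]),
      hk 17 (by simp [IsKept]), hk 6 (by simp [IsKept])]
    obtain ⟨g1, g2⟩ := hm a ha
    split_ifs with hc
    · exact ⟨le_rfl, iff_of_true rfl ⟨i, by omega, hc⟩⟩
    · refine ⟨g1, g2.trans ⟨?_, ?_⟩⟩
      · rintro ⟨i', hi', h⟩
        exact ⟨i', by omega, h⟩
      · rintro ⟨i', hi', h⟩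
        refine ⟨i', ?_, h⟩
        rcases Nat.lt_succ_iff_lt_or_eq.1 hi' with h' | rfl
        · exact h'
        · exact absurd h hc)
  set s₁ := exec nb (.loop 5 markCmd) (exec nb (.set 12 0) (m, st)) with hs₁
  have h5 : (exec nb (.set 12 0) (m, st)).1 5 = m 5 := by simp [exec]
  have hst : (exec nb (.set 12 0) (m, st)).2 = st + 1 := by simp [exec]
  rw [h5, hst] at hloop₁
  obtain ⟨⟨hk₁, -, hm₁⟩, hc₁⟩ := hloop₁
  set s₂ := exec nb (.add 22 5 11) (exec nb (.set 12 0) s₁) with hs₂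
  have hk₂ : ∀ a, IsKept a → s₂.1 a = m a := by
    intro a ha
    have h22 : a ≠ 22 := by
      rintro rfl
      simp [IsKept] at ha
    simp only [hs₂, exec, Function.update_of_ne h22, Function.update_of_ne (hkept a ha)]
    exact hk₁ a ha
  have hm₂ : ∀ a, 32 ≤ a → s₂.1 a = s₁.1 a := by
    intro a ha
    have h22 : a ≠ 22 := by omega
    have h12 : a ≠ 12 := by omega
    simp only [hs₂, exec, Function.update_of_ne h22, Function.update_of_ne h12]
  have h22 : s₂.1 22 = m 5 + 1 := by
    simp [hs₂, exec, hk₁ 5 (by simp [IsKept]), hk₁ 11 (by simp [IsKept]), h11]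
  have h12₂ : s₂.1 12 = 0 := by simp [hs₂, exec]
  have hst₂ : s₂.2 = s₁.2 + 2 := by simp [hs₂, exec]
  set Inv₂ : ℕ → (ℕ → ℕ) → Prop := fun i m' => (∀ a, IsKept a → m' a = m a) ∧ m' 12 = i ∧
    (∀ a, 32 ≤ a → m' a = s₁.1 a) ∧
    ((∃ c < i, s₁.1 (32 + c) < m 6) → m' 21 < i ∧ s₁.1 (32 + m' 21) < m 6) with hInv₂
  have hloop₂ := exec_loop_inv nb 22 scanCmd s₂ Inv₂ 5
    ⟨hk₂, h12₂, hm₂, by simp⟩ (by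
    rintro i m' st' - ⟨hk, h12, hm, h21⟩
    obtain ⟨e1, e2, e3, e4, e5⟩ := exec_scanCmd nb m' st'
      ((hk 18 (by simp [IsKept])).trans h18) ((hk 11 (by simp [IsKept])).trans h11)
      ((hk 10 (by simp [IsKept])).trans h10)
    refine ⟨⟨fun a ha => (e1 a ha).trans (hk a ha), by rw [e2, h12],
      fun a ha => (e3 a ha).trans (hm a ha), ?_⟩, e5⟩
    rw [e4, h12, hm _ (by omega), hk 6 (by simp [IsKept])]
    rintro ⟨c, hc, hc'⟩
    split_ifs with hi
    · exact ⟨by omega, hi⟩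
    · have : c < i := by
        rcases Nat.lt_succ_iff_lt_or_eq.1 hc with h' | rfl
        · exact h'
        · exact absurd hc' hi
      obtain ⟨g1, g2⟩ := h21 ⟨c, this, hc'⟩
      exact ⟨by omega, g2⟩)
  set s₃ := exec nb (.loop 22 scanCmd) s₂ with hs₃
  rw [h22, hst₂] at hloop₂
  obtain ⟨⟨hk₃, -, hm₃, h21⟩, hc₃⟩ := hloop₂
  -- the neighbours have at most `m 5` colours, so one of `m 5 + 1` colours is not marked
  have hfree : ∃ c < m 5 + 1, s₁.1 (32 + c) < m 6 := by
    by_contra! hno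
    have hsub : Finset.range (m 5 + 1) ⊆ (Finset.range (m 5)).image fun i => nb i / m 2 := by
      intro c hc
      have hcl := hno c (Finset.mem_range.1 hc)
      obtain ⟨g1, g2⟩ := hm₁ (32 + c) (by omega)
      obtain ⟨i, hi, -, hic⟩ := g2.1 (le_antisymm g1 hcl)
      exact Finset.mem_image.2 ⟨i, Finset.mem_range.2 hi, by omega⟩
    have := (Finset.card_le_card hsub).trans Finset.card_image_le
    simp at this
  obtain ⟨hlt, hun⟩ := h21 hfree
  have h10₃ := (hk₃ 10 (by simp [IsKept])).trans h10
  simp only [exec, h10₃, add_zero]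
  refine ⟨fun a ha h8 => ?_, ?_, ?_, ?_, ?_⟩
  · rw [Function.update_of_ne h8]
    exact hk₃ a ha
  · simp only [Function.update_self]
    omega
  · intro i hi hg
    simp only [Function.update_self]
    rintro h
    have := (hm₁ (32 + s₃.1 21) (by omega)).2.2 ⟨i, hi, hg, by rw [h]⟩
    omega
  · intro a ha
    rw [Function.update_of_ne (by omega), hm₃ a ha]
    exact (hm₁ a ha).1
  · omega

/-- The memory `m` of a processor with identifier `k` and `deg` neighbours that has completed
`ph` phases and has colour `c`. The marks are round numbers of the past. -/
structure VertexState (n Δ k deg ph c : ℕ) (m : ℕ → ℕ) : Prop where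
  word : m 0 = c * n + k
  wake : m 1 = 1 + ph * (Δ + 1) + c
  size : m 2 = n
  ident : m 4 = k
  degree : m 5 = deg
  group : m 7 = 2 ^ ph
  colour : m 8 = c
  period : m 9 = Δ + 1
  zero : m 10 = 0
  one : m 11 = 1
  base : m 18 = 32
  marks : ∀ a, 32 ≤ a → m a < m 1

variable {n Δ k deg ph c : ℕ} {m : ℕ → ℕ}

lemma exec_colouringCmd_init (nb : ℕ → ℕ) (hm : ∀ a, m a = if a = 2 then n else if a = 3 then Δ
    else if a = 4 then k else if a = 5 then deg else 0) :
    let s := exec nb colouringCmd (Function.update m 6 0, 1)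
    VertexState n Δ k deg 0 0 s.1 ∧ s.2 = 8 := by
  intro s
  simp only [s, colouringCmd, initCmd, exec]
  simp only [Function.update_apply, hm]
  refine ⟨⟨?_, ?_, ?_, ?_, ?_, ?_, ?_, ?_, ?_, ?_, ?_, ?_⟩, ?_⟩
  all_goals simp [hm]
  intro a ha
  have : a ≠ 0 ∧ a ≠ 1 ∧ a ≠ 2 ∧ a ≠ 3 ∧ a ≠ 4 ∧ a ≠ 5 ∧ a ≠ 6 ∧ a ≠ 7 ∧ a ≠ 9 ∧ a ≠ 11 ∧
    a ≠ 18 := by omega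
  simp [hm, this]

/-- The last activation publishes the colour. -/
lemma exec_colouringCmd_finish (nb : ℕ → ℕ) (hm : VertexState n Δ k deg ph c m)
    (hph : n ≤ 2 ^ ph) :
    let s := exec nb colouringCmd (Function.update m 6 (m 1), 1)
    s.1 0 = c ∧ s.1 1 = 0 ∧ s.2 = 5 := by
  intro s
  have h1 : 0 < m 1 := by
    rw [hm.wake]
    omega
  have h2 : ¬ m 7 < m 2 := by
    rw [hm.group, hm.size]
    omega
  simp only [s, colouringCmd, finishCmd, exec]
  simp [hm.zero, h1, h2, hm.colour]

/-- One phase of one vertex. -/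
lemma exec_colouringCmd_phase (nb : ℕ → ℕ) (hm : VertexState n Δ k deg ph c m)
    (hph : 2 ^ ph < n) (hdeg : deg ≤ Δ) (hc : c ≤ Δ) :
    let s := exec nb colouringCmd (Function.update m 6 (m 1), 1)
    ∃ c' ≤ Δ, VertexState n Δ k deg (ph + 1) c' s.1 ∧ s.2 ≤ 32 * (deg + 1) ∧
      if k / 2 ^ ph % 2 = 1 then
        ∀ i < deg, nb i % n / 2 ^ (ph + 1) = k / 2 ^ (ph + 1) → nb i / n ≠ c'
      else c' = c := by
  intro s
  have h1 : 0 < m 1 := by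
    rw [hm.wake]
    omega
  have h2 : m 7 < m 2 := by rwa [hm.group, hm.size]
  have hpow : (2 : ℕ) ^ (ph + 1) = 2 ^ ph + 2 ^ ph := by ring
  -- the memory before the test whether to choose a new colour
  set r := exec nb (.mod 20 20 22) (exec nb (.set 22 2) (exec nb (.div 20 4 7)
    (exec nb (.div 17 4 19) (exec nb (.add 19 7 7) (Function.update m 6 (m 1), 3))))) with hr
  set r' := exec nb (.sub 1 1 8) r with hr'
  have hr1 : r'.1 = Function.update (Function.update (Function.update (Function.update
    (Function.update (Function.update (Function.update m 6 (m 1)) 19 (2 ^ (ph + 1)))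
      17 (k / 2 ^ (ph + 1))) 20 (k / 2 ^ ph)) 22 2) 20 (k / 2 ^ ph % 2)) 1
      (1 + ph * (Δ + 1)) := by
    simp only [hr', hr, exec]
    simp [hm.group, hm.ident, hpow, hm.wake, hm.colour]
  have hr2 : r'.2 = 9 := by simp [hr', hr, exec]
  have hs : s = exec nb (.add 0 0 4) (exec nb (.mul 0 8 2) (exec nb (.add 7 19 10)
      (exec nb (.add 1 1 8) (exec nb (.add 1 1 9)
        (exec nb (.ifLt 10 20 recolourCmd (.set 22 0)) r'))))) := by
    simp only [s, colouringCmd, phaseCmd]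
    rw [exec_ifLt_of_lt _ _ _ (by simp [hm.zero, h1]), exec_ifLt_of_lt _ _ _ (by simpa using h2)]
    simp only [exec_seq, hr', hr]
  set q := exec nb (.ifLt 10 20 recolourCmd (.set 22 0)) r' with hq
  have hreg : ∀ a, IsKept a → a ≠ 1 → a ≠ 6 → a ≠ 17 → a ≠ 19 → r'.1 a = m a := by
    intro a ha h1 h6 h17 h19
    have : a ≠ 20 ∧ a ≠ 22 := by
      constructor <;> rintro rfl <;> simp [IsKept] at ha
    rw [hr1]
    simp [*]
  have hq' : ∃ c' ≤ Δ, q.1 8 = c' ∧ (∀ a, IsKept a → a ≠ 8 → q.1 a = r'.1 a) ∧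
      (∀ a, 32 ≤ a → q.1 a ≤ m 1) ∧ q.2 ≤ 10 + 16 * (deg + 1) ∧
      if k / 2 ^ ph % 2 = 1 then
        ∀ i < deg, nb i % n / 2 ^ (ph + 1) = k / 2 ^ (ph + 1) → nb i / n ≠ c'
      else c' = c := by
    have hmarks : ∀ a, 32 ≤ a → r'.1 a < m 1 := by
      intro a ha
      have := hm.marks a ha
      rw [hr1]
      simp only [Function.update_apply]
      grind
    have h6 : r'.1 6 = m 1 := by rw [hr1]; simp
    have h20 : r'.1 20 = k / 2 ^ ph % 2 := by rw [hr1]; simp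
    have h10 : r'.1 10 = 0 := by rw [hr1]; simp [hm.zero]
    by_cases hodd : k / 2 ^ ph % 2 = 1
    · simp only [if_pos hodd]
      have hqe : q = exec nb recolourCmd (r'.1, r'.2 + 1) := by
        rw [hq, exec_ifLt_of_lt _ _ _ (by rw [h10, h20]; omega)]
      obtain ⟨e1, e2, e3, e4, e5⟩ := exec_recolourCmd nb r'.1 (r'.2 + 1)
        (by rw [hr1]; simp [hm.base])
        (by rw [hr1]; simp [hm.one]) h10 (by rwa [h6])
      rw [← hqe] at e1 e2 e3 e4 e5
      have h5 : r'.1 5 = deg := by rw [hr1]; simp [hm.degree]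
      have hn : r'.1 2 = n := by rw [hr1]; simp [hm.size]
      have h19 : r'.1 19 = 2 ^ (ph + 1) := by rw [hr1]; simp
      have h17 : r'.1 17 = k / 2 ^ (ph + 1) := by rw [hr1]; simp
      rw [h5] at e2 e3 e5
      rw [h6] at e4
      rw [hn, h19, h17] at e3
      exact ⟨q.1 8, by omega, rfl, e1, e4, by omega, e3⟩
    · simp only [if_neg hodd]
      have hqe : q = (Function.update r'.1 22 0, r'.2 + 2) := by
        rw [hq, exec, if_neg (by rw [h10, h20]; omega), exec]
      refine ⟨c, hc, ?_, ?_, ?_, ?_, rfl⟩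
      · rw [hqe, hr1]
        simp [hm.colour]
      · intro a ha _
        have : a ≠ 22 := by
          rintro rfl
          simp [IsKept] at ha
        simp only [hqe, Function.update_of_ne this]
      · intro a ha
        have : a ≠ 22 := by omega
        simp only [hqe, Function.update_of_ne this]
        exact (hmarks a ha).le
      · rw [hqe]
        simp only
        omega
  obtain ⟨c', hc', h8, hk, hmk, hst, hcol⟩ := hq'
  refine ⟨c', hc', ?_, ?_, hcol⟩
  · have g1 : q.1 1 = 1 + ph * (Δ + 1) := by
      rw [hk 1 (by simp [IsKept]) (by simp), hr1]
      simp
    have g19 : q.1 19 = 2 ^ (ph + 1) := by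
      rw [hk 19 (by simp [IsKept]) (by simp), hr1]
      simp
    have gk : ∀ a, a = 2 ∨ a = 4 ∨ a = 5 ∨ a = 9 ∨ a = 10 ∨ a = 11 ∨ a = 18 → q.1 a = m a := by
      intro a ha
      have hka : IsKept a := by
        unfold IsKept
        omega
      rw [hk a hka (by omega), hreg a hka] <;> omega
    have g2 := (gk 2 (by simp)).trans hm.size
    have g4 := (gk 4 (by simp)).trans hm.ident
    have g5 := (gk 5 (by simp)).trans hm.degree
    have g9 := (gk 9 (by simp)).trans hm.period
    have g10 := (gk 10 (by simp)).trans hm.zero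
    have g11 := (gk 11 (by simp)).trans hm.one
    have g18 := (gk 18 (by simp)).trans hm.base
    have hw : s.1 1 = 1 + (ph + 1) * (Δ + 1) + c' := by
      rw [hs]
      simp [exec, g1, g9, h8]
      ring
    refine ⟨?_, hw, ?_, ?_, ?_, ?_, ?_, ?_, ?_, ?_, ?_, fun a ha => ?_⟩
    · rw [hs]; simp [exec, h8, g2, g4]
    · rw [hs]; simp [exec, g2]
    · rw [hs]; simp [exec, g4]
    · rw [hs]; simp [exec, g5]
    · rw [hs]; simp [exec, g19, g10]
    · rw [hs]; simp [exec, h8]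
    · rw [hs]; simp [exec, g9]
    · rw [hs]; simp [exec, g10]
    · rw [hs]; simp [exec, g11]
    · rw [hs]; simp [exec, g18]
    · have : s.1 a = q.1 a := by
        rw [hs]
        have : a ≠ 0 ∧ a ≠ 1 ∧ a ≠ 7 := by omega
        simp [exec, this]
      rw [this, hw]
      refine (hmk a ha).trans_lt ?_
      rw [hm.wake, add_mul]
      omega
  · have : s.2 = q.2 + 5 := by rw [hs]; simp [exec]
    omega

end Program

/-! ### Correctness and cost of the colouring -/

section Network

variable {n Δ : ℕ} {G : SimpleGraph (Fin n)} {nbrs : Fin n → List (Fin n)}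

/-- The network in phase `b`, when the vertices of old colour less than `c` have completed the
phase: vertex `k` has completed `ph k` phases and has colour `col k`. Neighbours in the same group
of size `2 ^ b` have different colours, and so do neighbours in the two halves of a group
of size `2 ^ (b + 1)` once the vertex in the upper half has completed the phase.
Phase `B` is the one in which the vertices publish their colours. -/
structure NetInv (G : SimpleGraph (Fin n)) (nbrs : Fin n → List (Fin n)) (Δ B b c : ℕ)
    (mem : Fin n → ℕ → ℕ) (ph col : Fin n → ℕ) : Prop where
  running : ∀ k, ph k ≤ B → VertexState n Δ k (nbrs k).length (ph k) (col k) (mem k)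
  finished : ∀ k, B < ph k → mem k 0 = col k ∧ mem k 1 = 0
  col_le : ∀ k, col k ≤ Δ
  sched : ∀ k, ph k = b ∧ c ≤ col k ∨ ph k = b + 1
  within : ∀ i j, G.Adj i j → (i : ℕ) / 2 ^ b = j / 2 ^ b → col i ≠ col j
  across : ∀ i j, G.Adj i j → (i : ℕ) / 2 ^ (b + 1) = j / 2 ^ (b + 1) → (i : ℕ) / 2 ^ b % 2 = 0 →
    (j : ℕ) / 2 ^ b % 2 = 1 → ph j = b + 1 → col i ≠ col j

lemma div_two_pow_succ (a b : ℕ) : a / 2 ^ (b + 1) = a / 2 ^ b / 2 := by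
  rw [pow_succ, Nat.div_div_eq_div_mul]

/-- The cost of processor `k` in round `t`. -/
def roundCost (prog : Cmd) (nbrs : Fin n → List (Fin n)) (Δ t : ℕ) (k : Fin n) : ℕ :=
  if netState prog nbrs Δ t k 1 = t then (activate prog nbrs t (netState prog nbrs Δ t) k).2
  else 0

/-- One round. -/
lemma NetInv.step (hmem : ∀ k j, j ∈ nbrs k ↔ G.Adj k j) (hlen : ∀ k, (nbrs k).length ≤ Δ)
    {B b c : ℕ} (hB : ∀ b < B, 2 ^ b < n) (hnB : n ≤ 2 ^ B) (hb : b ≤ B)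
    (hc : c ≤ Δ) {ph col : Fin n → ℕ} {t : ℕ} (ht : t = 1 + b * (Δ + 1) + c)
    (h : NetInv G nbrs Δ B b c (netState colouringCmd nbrs Δ t) ph col) :
    ∃ ph' col', NetInv G nbrs Δ B b (c + 1) (netState colouringCmd nbrs Δ (t + 1)) ph' col' ∧
      ∀ k, roundCost colouringCmd nbrs Δ t k + 32 * ((nbrs k).length + 1) * ph k ≤
        32 * ((nbrs k).length + 1) * ph' k := by
  have hloc : ∀ k : Fin n, ∃ ph' col', col' ≤ Δ ∧
      (ph' ≤ B → VertexState n Δ k (nbrs k).length ph' col'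
        (netState colouringCmd nbrs Δ (t + 1) k)) ∧
      (B < ph' → netState colouringCmd nbrs Δ (t + 1) k 0 = col' ∧
        netState colouringCmd nbrs Δ (t + 1) k 1 = 0) ∧
      (ph' = b ∧ c + 1 ≤ col' ∨ ph' = b + 1) ∧
      (roundCost colouringCmd nbrs Δ t k + 32 * ((nbrs k).length + 1) * ph k ≤
        32 * ((nbrs k).length + 1) * ph') ∧
      ((ph' = ph k ∧ col' = col k) ∨ (col k = c ∧ ph k = b ∧
        (((k : ℕ) / 2 ^ b % 2 = 1 ∧ ∀ j, G.Adj k j →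
          (j : ℕ) / 2 ^ (b + 1) = k / 2 ^ (b + 1) → col j ≠ col') ∨
        ((k : ℕ) / 2 ^ b % 2 = 0 ∧ col' = col k)))) := by
    intro k
    have hnext : netState colouringCmd nbrs Δ (t + 1) k =
        if netState colouringCmd nbrs Δ t k 1 = t then
          (activate colouringCmd nbrs t (netState colouringCmd nbrs Δ t) k).1
        else netState colouringCmd nbrs Δ t k := rfl
    by_cases haw : ph k = b ∧ col k = c
    · -- the processor is awake
      obtain ⟨hphk, hck⟩ := haw
      have hv := h.running k (by omega)
      have hwake : netState colouringCmd nbrs Δ t k 1 = t := by rw [hv.wake, hphk, hck, ht]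
      rw [hnext, if_pos hwake, roundCost, if_pos hwake, activate]
      set nb : ℕ → ℕ := fun i =>
        (((nbrs k)[i]?).map fun j => netState colouringCmd nbrs Δ t j 0).getD 0 with hnb
      have hupd : Function.update (netState colouringCmd nbrs Δ t k) 6 t =
          Function.update (netState colouringCmd nbrs Δ t k) 6
            (netState colouringCmd nbrs Δ t k 1) := by rw [hwake]
      rw [hupd]
      rcases hb.lt_or_eq with hbB | rfl
      · obtain ⟨c', hc', hv', hst, hcol⟩ := exec_colouringCmd_phase nb hv
          (by rw [hphk]; exact hB b hbB) (hlen k) (h.col_le k)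
        rw [hphk] at hv' hcol
        refine ⟨b + 1, c', hc', fun _ => hv', fun hlt => by omega, Or.inr rfl, ?_,
          Or.inr ⟨hck, hphk, ?_⟩⟩
        · rw [hphk]
          calc _ ≤ 32 * ((nbrs k).length + 1) + 32 * ((nbrs k).length + 1) * b := by gcongr
            _ = _ := by ring
        · split_ifs at hcol with hodd
          · refine Or.inl ⟨hodd, fun j hj hg => ?_⟩
            obtain ⟨i, hi, hij⟩ := List.getElem_of_mem ((hmem k j).2 hj)
            have hphj : ph j ≤ B := by rcases h.sched j with h' | h' <;> omega
            have hword : nb i = col j * n + j := by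
              simp only [hnb, List.getElem?_eq_getElem hi, hij, Option.map_some,
                Option.getD_some]
              exact (h.running j hphj).word
            have hmod : nb i % n = j := by
              rw [hword, Nat.mul_add_mod_self_right, Nat.mod_eq_of_lt j.2]
            have hdiv : nb i / n = col j := by
              have hn : 0 < n := j.pos
              rw [hword, mul_comm, Nat.mul_add_div hn, Nat.div_eq_of_lt j.2, add_zero]
            have := hcol i hi (by rw [hmod, hg])
            rwa [hdiv] at this
          · exact Or.inr ⟨by omega, hcol⟩
      · obtain ⟨e0, e1, e2⟩ := exec_colouringCmd_finish nb hv (by rwa [hphk])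
        refine ⟨b + 1, col k, h.col_le k, fun hle => by omega, fun _ => ⟨e0, e1⟩,
          Or.inr rfl, ?_, Or.inr ⟨hck, hphk, Or.inr ⟨?_, rfl⟩⟩⟩
        · rw [e2, hphk]
          nlinarith
        · rw [Nat.div_eq_of_lt (k.2.trans_le hnB)]
    · -- the processor is asleep
      have hsleep : netState colouringCmd nbrs Δ t k 1 ≠ t := by
        by_cases hB' : ph k ≤ B
        · rw [(h.running k hB').wake]
          rcases h.sched k with ⟨h1, h2⟩ | h1
          · rw [h1, ht]
            have : col k ≠ c := fun hc => haw ⟨h1, hc⟩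
            omega
          · rw [h1, ht, add_mul, one_mul]
            omega
        · rw [(h.finished k (by omega)).2, ht]
          omega
      rw [hnext, if_neg hsleep, roundCost, if_neg hsleep]
      refine ⟨ph k, col k, h.col_le k, h.running k, h.finished k, ?_, by omega, Or.inl ⟨rfl, rfl⟩⟩
      rcases h.sched k with ⟨h1, h2⟩ | h1
      · have : col k ≠ c := fun hc => haw ⟨h1, hc⟩
        exact Or.inl ⟨h1, by omega⟩
      · exact Or.inr h1
  choose ph' col' h1 h2 h3 h4 h5 h6 using hloc
  have hparity : ∀ i j : Fin n, (i : ℕ) / 2 ^ b = j / 2 ^ b →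
      (i : ℕ) / 2 ^ (b + 1) = j / 2 ^ (b + 1) := fun i j hij => by
    rw [div_two_pow_succ, div_two_pow_succ, hij]
  refine ⟨ph', col', ⟨h2, h3, h1, h4, ?_, ?_⟩, h5⟩
  · intro i j hij hg
    have hold := h.within i j hij hg
    have hold' : col j ≠ col i := hold.symm
    rcases h6 i with ⟨-, hi⟩ | ⟨hci, -, ⟨-, hi⟩ | ⟨-, hi⟩⟩ <;>
      rcases h6 j with ⟨-, hj⟩ | ⟨hcj, -, ⟨-, hj⟩ | ⟨-, hj⟩⟩
    · rwa [hi, hj]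
    · rw [hi]
      exact hj i hij.symm (hparity i j hg)
    · rwa [hi, hj]
    · rw [hj]
      exact (hi j hij (hparity i j hg).symm).symm
    · exact absurd (hci.trans hcj.symm) hold
    · exact absurd (hci.trans hcj.symm) hold
    · rwa [hi, hj]
    · exact absurd (hci.trans hcj.symm) hold
    · rwa [hi, hj]
  · intro i j hij hg hi0 hj1 hphj
    have hi : col' i = col i := by
      rcases h6 i with ⟨-, hi⟩ | ⟨-, -, ⟨hi, -⟩ | ⟨-, hi⟩⟩
      · exact hi
      · omega
      · exact hi
    rcases h6 j with ⟨hp, hj⟩ | ⟨-, -, ⟨-, hj⟩ | ⟨hj, -⟩⟩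
    · rw [hi, hj]
      exact h.across i j hij hg hi0 hj1 (by omega)
    · rw [hi]
      exact hj i hij.symm hg
    · omega

/-- When all old colours have had their turn, the next phase begins. -/
lemma NetInv.next_phase {B b : ℕ} {mem : Fin n → ℕ → ℕ} {ph col : Fin n → ℕ}
    (h : NetInv G nbrs Δ B b (Δ + 1) mem ph col) : NetInv G nbrs Δ B (b + 1) 0 mem ph col := by
  have hph : ∀ k, ph k = b + 1 := by
    intro k
    have := h.col_le k
    rcases h.sched k with ⟨-, h'⟩ | h'
    · omega
    · exact h'
  refine ⟨h.running, h.finished, h.col_le, fun k => Or.inl ⟨hph k, Nat.zero_le _⟩, ?_, ?_⟩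
  · intro i j hij hg
    have hg' := hg
    rw [div_two_pow_succ, div_two_pow_succ] at hg'
    rcases Nat.mod_two_eq_zero_or_one ((i : ℕ) / 2 ^ b) with hi | hi <;>
      rcases Nat.mod_two_eq_zero_or_one ((j : ℕ) / 2 ^ b) with hj | hj
    · exact h.within i j hij (by omega)
    · exact h.across i j hij hg hi hj (hph j)
    · exact (h.across j i hij.symm hg.symm hj hi (hph i)).symm
    · exact h.within i j hij (by omega)
  · intro i j _ _ _ _ hj
    have := hph j
    omega

/-- The program computes a proper colouring in `1 + (⌈log₂ n⌉ + 1) * (Δ + 1)` rounds, and processor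
`k` makes at most `32 * (deg k + 1) * (⌈log₂ n⌉ + 2)` steps. -/
lemma exists_colouring (hmem : ∀ k j, j ∈ nbrs k ↔ G.Adj k j)
    (hlen : ∀ k, (nbrs k).length ≤ Δ) :
    ∃ col : Fin n → Fin (Δ + 1),
      HaltsWithin colouringCmd nbrs Δ (1 + (Nat.clog 2 n + 1) * (Δ + 1)) ∧
      (∀ k, netState colouringCmd nbrs Δ (1 + (Nat.clog 2 n + 1) * (Δ + 1)) k 0 = (col k : ℕ)) ∧
      (∀ i j, G.Adj i j → col i ≠ col j) ∧
      netWork colouringCmd nbrs Δ (1 + (Nat.clog 2 n + 1) * (Δ + 1)) ≤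
        32 * (Nat.clog 2 n + 2) * ∑ k, ((nbrs k).length + 1) := by
  set B := Nat.clog 2 n with hBdef
  have hB : ∀ b < B, 2 ^ b < n := fun b hb => (Nat.lt_clog_iff_pow_lt (by norm_num)).1 hb
  have hnB : n ≤ 2 ^ B := Nat.le_pow_clog (by norm_num) n
  set Good : ℕ → ℕ → Prop := fun b c => ∃ ph col,
    NetInv G nbrs Δ B b c (netState colouringCmd nbrs Δ (1 + b * (Δ + 1) + c)) ph col ∧
    ∀ k, ∑ t ∈ Finset.range (1 + b * (Δ + 1) + c), roundCost colouringCmd nbrs Δ t k ≤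
      32 * ((nbrs k).length + 1) * (ph k + 1) with hGood
  have hbase : Good 0 0 := by
    have hinit : ∀ k : Fin n, VertexState n Δ k (nbrs k).length 0 0 (netState colouringCmd nbrs Δ 1 k) ∧
        (activate colouringCmd nbrs 0 (netInit nbrs Δ) k).2 = 8 := by
      intro k
      have h1 : netState colouringCmd nbrs Δ 1 k =
          (activate colouringCmd nbrs 0 (netInit nbrs Δ) k).1 := by
        simp [netState, netInit]
      rw [h1, activate]
      exact exec_colouringCmd_init _ fun a => rfl
    refine ⟨fun _ => 0, fun _ => 0, ⟨fun k _ => ?_, fun k hk => by omega, fun k => Nat.zero_le _,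
      fun k => Or.inl ⟨rfl, le_rfl⟩, ?_, ?_⟩, fun k => ?_⟩
    · simpa using (hinit k).1
    · intro i j hij hg
      refine absurd (Fin.ext ?_) hij.ne
      simpa using hg
    · intro i j _ _ _ _ h
      simp at h
    · have : roundCost colouringCmd nbrs Δ 0 k = 8 := by
        rw [roundCost, if_pos (by simp [netState, netInit])]
        exact (hinit k).2
      simp [this]
      omega
  have hrow : ∀ b ≤ B, Good b 0 → ∀ c ≤ Δ + 1, Good b c := by
    intro b hb h0 c
    induction c with
    | zero => exact fun _ => h0
    | succ c ih =>
      intro hc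
      obtain ⟨ph, col, hI, hw⟩ := ih (by omega)
      obtain ⟨ph', col', hI', hw'⟩ := hI.step hmem hlen hB hnB hb (by omega) rfl
      refine ⟨ph', col', hI', fun k => ?_⟩
      rw [← add_assoc, Finset.sum_range_succ]
      have e1 := hw k
      have e2 := hw' k
      rw [Nat.mul_add_one (32 * _)] at e1 ⊢
      omega
  have hall : ∀ b ≤ B + 1, Good b 0 := by
    intro b
    induction b with
    | zero => exact fun _ => hbase
    | succ b ih =>
      intro hb
      obtain ⟨ph, col, hI, hw⟩ := hrow b (by omega) (ih (by omega)) (Δ + 1) le_rfl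
      have ht : 1 + (b + 1) * (Δ + 1) + 0 = 1 + b * (Δ + 1) + (Δ + 1) := by ring
      refine ⟨ph, col, ?_, ?_⟩
      · rw [ht]
        exact hI.next_phase
      · rwa [ht]
  obtain ⟨ph, col, hI, hw⟩ := hrow B le_rfl (hall B (by omega)) (Δ + 1) le_rfl
  have ht : 1 + (B + 1) * (Δ + 1) = 1 + B * (Δ + 1) + (Δ + 1) := by ring
  rw [← ht] at hI hw
  have hph : ∀ k, ph k = B + 1 := by
    intro k
    have := hI.col_le k
    rcases hI.sched k with ⟨-, h'⟩ | h'
    · omega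
    · exact h'
  have hfin : ∀ k : Fin n, _ := fun k => hI.finished k (by rw [hph k]; omega)
  refine ⟨fun k => ⟨col k, Nat.lt_succ_of_le (hI.col_le k)⟩, fun k => ?_, fun k => (hfin k).1,
    ?_, ?_⟩
  · rw [(hfin k).2]
    omega
  · intro i j hij heq
    refine hI.within i j hij ?_ (Fin.mk.inj_iff.1 heq)
    rw [Nat.div_eq_of_lt (i.2.trans_le hnB), Nat.div_eq_of_lt (j.2.trans_le hnB)]
  · rw [netWork, Finset.sum_comm, Finset.mul_sum]
    refine Finset.sum_le_sum fun k _ => (hw k).trans ?_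
    rw [hph k]
    apply le_of_eq
    ring

end Network

/-! ### Counting entries, edges and updates -/

section Counting

variable {n p : ℕ} {K : Matrix (Fin n) (Fin n) ℝ}

lemma sum_nnzAt (K : Matrix (Fin n) (Fin n) ℝ) : ∑ k, nnzAt K k = 2 * nnz K := by
  classical
  have h1 : ∑ k, (Finset.univ.filter fun j => K k j ≠ 0).card = nnz K := by
    unfold nnz
    simp only [Finset.card_filter]
    exact (Fintype.sum_prod_type fun e : Fin n × Fin n => if K e.1 e.2 ≠ 0 then 1 else 0).symm
  have h2 : ∑ k, (Finset.univ.filter fun i => K i k ≠ 0).card = nnz K := by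
    rw [← h1]
    simp only [Finset.card_filter]
    exact Finset.sum_comm
  unfold nnzAt
  rw [Finset.sum_add_distrib, two_mul]
  convert congrArg₂ (· + ·) h1 h2

lemma sum_blockWork (K : Matrix (Fin n) (Fin n) ℝ) (col : Fin n → Fin p) :
    ∑ l, blockWork K col l = p + n + 2 * nnz K := by
  classical
  unfold blockWork
  rw [Finset.sum_add_distrib, Finset.sum_comm]
  simp [Finset.sum_add_distrib, sum_nnzAt]
  ring

lemma mem_neighbours (K : Matrix (Fin n) (Fin n) ℝ) (k j : Fin n) :
    j ∈ neighbours K k ↔ (supportGraph K).Adj k j := by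
  classical
  simp [neighbours]

lemma length_neighbours_le_maxDeg (K : Matrix (Fin n) (Fin n) ℝ) (k : Fin n) :
    (neighbours K k).length ≤ maxDeg K := by
  classical
  rw [neighbours, Finset.length_sort, SimpleGraph.card_neighborFinset_eq_degree, maxDeg]
  convert SimpleGraph.degree_le_maxDegree _ _

lemma length_neighbours_le_nnzAt (K : Matrix (Fin n) (Fin n) ℝ) (k : Fin n) :
    (neighbours K k).length ≤ nnzAt K k := by
  classical
  rw [neighbours, Finset.length_sort]
  unfold nnzAt
  refine le_trans (Finset.card_le_card ?_) (Finset.card_union_le _ _)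
  intro j hj
  rw [SimpleGraph.mem_neighborFinset, supportGraph, SimpleGraph.fromRel_adj] at hj
  simp only [Finset.mem_union, Finset.mem_filter, Finset.mem_univ, true_and]
  exact hj.2.imp (fun h => h.ne') fun h => h.ne'

lemma maxDeg_lt (hn : 2 ≤ n) (K : Matrix (Fin n) (Fin n) ℝ) : maxDeg K < n := by
  classical
  have : Nonempty (Fin n) := ⟨⟨0, by omega⟩⟩
  have h := SimpleGraph.maxDegree_lt_card_verts (supportGraph K)
  rw [Fintype.card_fin] at h
  unfold maxDeg
  convert h

lemma one_le_maxDeg (hn : 2 ≤ n) (hK : K.IsIrreducible) : 1 ≤ maxDeg K := by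
  by_contra! h0
  -- without edges of the support graph, paths of the digraph do not leave their start
  have hedge : ∀ i j, 0 < K i j → i = j := by
    intro i j hij
    by_contra hne
    have hmem : j ∈ neighbours K i := by
      rw [mem_neighbours, supportGraph, SimpleGraph.fromRel_adj]
      exact ⟨hne, Or.inl hij⟩
    have := List.length_pos_of_mem hmem
    have := length_neighbours_le_maxDeg K i
    omega
  have hpath : ∀ i j (_ : @Quiver.Path (Fin n) K.toQuiver i j), i = j := by
    intro i j q
    let := K.toQuiver
    induction q with
    | nil => rfl
    | cons _ e ih => exact ih.trans (hedge _ _ e.down)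
  obtain ⟨q, -⟩ := hK.connected ⟨0, by omega⟩ ⟨1, by omega⟩
  have := hpath _ _ q
  simp at this

lemma coe_lt_numUpdates_iff (ε : ℝ) (col : Fin n → Fin p) (ω : ℕ → Fin p) (t : ℕ) :
    (t : ℕ∞) < numUpdates K ε col ω ↔
      Alive (fun t ω => iterate K col ω t) (fun x => IsEpsBalanced ε (scaling K x)) t ω := by
  constructor
  · intro h s hs hbal
    refine absurd (h.trans_le (iInf₂_le s hbal)) ?_
    simpa using hs
  · intro h
    have h1 : ((t + 1 : ℕ) : ℕ∞) ≤ numUpdates K ε col ω := by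
      refine le_iInf₂ fun s hs => ?_
      have : t < s := by
        by_contra hle
        exact h s (not_lt.1 hle) hs
      exact_mod_cast this
    refine lt_of_lt_of_le ?_ h1
    exact_mod_cast Nat.lt_succ_self t

lemma toENNReal_eq_tsum (N : ℕ∞) :
    (N : ℝ≥0∞) = ∑' t : ℕ, if (t : ℕ∞) < N then (1 : ℝ≥0∞) else 0 := by
  induction N using ENat.recTopCoe with
  | top => simp
  | coe k =>
    rw [tsum_eq_sum (s := Finset.range k)]
    · rw [Finset.sum_congr rfl fun t ht => if_pos (by
        exact_mod_cast Finset.mem_range.1 ht)]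
      simp
    · intro t ht
      rw [if_neg]
      simpa using ht

lemma numUpdates_eq_totalCost (ε : ℝ) (col : Fin n → Fin p) (ω : ℕ → Fin p) :
    ((numUpdates K ε col ω : ℕ∞) : ℝ≥0∞) =
      totalCost (fun t ω => iterate K col ω t) (fun x => IsEpsBalanced ε (scaling K x))
        (fun _ => 1) ω := by
  rw [toENNReal_eq_tsum, totalCost]
  refine tsum_congr fun t => ?_
  simp only [stepCost, ← coe_lt_numUpdates_iff]
  split_ifs <;> simp

lemma parWork_eq_add_totalCost (ε : ℝ) (W : ℕ) (col : Fin n → Fin p) (ω : ℕ → Fin p) :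
    parWork K ε W col ω = (W + (n + nnz K) : ℕ) +
      totalCost (fun t ω => iterate K col ω t) (fun x => IsEpsBalanced ε (scaling K x))
        (blockWork K col) ω := by
  rw [parWork, totalCost]
  push_cast
  congr 1
  refine tsum_congr fun t => ?_
  simp only [stepCost, ← coe_lt_numUpdates_iff]
  split_ifs <;> simp

lemma exists_numUpdates_eq {ε : ℝ} {col : Fin n → Fin p} {ω : ℕ → Fin p}
    (h : numUpdates K ε col ω ≠ ⊤) : ∃ T : ℕ, numUpdates K ε col ω = T ∧
      IsEpsBalanced ε (scaling K (iterate K col ω T)) := by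
  obtain ⟨T, hT⟩ := ENat.ne_top_iff_exists.1 h
  refine ⟨T, hT.symm, ?_⟩
  have h1 : ¬ (T : ℕ∞) < numUpdates K ε col ω := by
    rw [hT]
    exact lt_irrefl _
  rw [coe_lt_numUpdates_iff, Alive] at h1
  push Not at h1
  obtain ⟨s, hs, hbal⟩ := h1
  have h2 : numUpdates K ε col ω ≤ s := iInf₂_le s hbal
  rw [← hT] at h2
  have h3 : T ≤ s := by exact_mod_cast h2
  rwa [le_antisymm h3 hs]

end Counting

/-! ### The bounds for rounds and work -/

section Bounds

variable {n p : ℕ} {K : Matrix (Fin n) (Fin n) ℝ} {ε : ℝ}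

/-- The factor `(1 / ε) * min (1 / ε) d * log κ` of all bounds. -/
def rate (K : Matrix (Fin n) (Fin n) ℝ) (ε : ℝ) : ℝ :=
  1 / ε * min (1 / ε) (dirDiam K) * Real.log (kappa K)

lemma log_kappa_le_rate (hn : 2 ≤ n) (hK : K.IsIrreducible) (hε : 0 < ε) (hε2 : ε < 2) :
    Real.log (kappa K) ≤ 4 * rate K ε := by
  have h1 : 1 / 2 ≤ 1 / ε := one_div_le_one_div_of_le hε hε2.le
  have hd : (1 : ℝ) ≤ dirDiam K := by exact_mod_cast one_le_dirDiam hn hK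
  have h2 : 1 / 2 ≤ min (1 / ε) (dirDiam K : ℝ) := le_min h1 (by linarith)
  have h3 : 1 / 4 ≤ 1 / ε * min (1 / ε) (dirDiam K : ℝ) := by nlinarith
  have := mul_le_mul_of_nonneg_right h3 (log_kappa_pos hn hK).le
  unfold rate
  linarith

lemma one_le_rate (hn : 2 ≤ n) (hK : K.IsIrreducible) (hε : 0 < ε) (hε2 : ε < 2) :
    1 ≤ 8 * rate K ε := by
  have h1 := log_kappa_le_rate hn hK hε hε2
  have h2 := Real.log_le_log (by norm_num) (two_le_kappa hn hK)
  have h3 := Real.log_two_gt_d9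
  linarith

lemma clog_le_rate (hn : 2 ≤ n) (hK : K.IsIrreducible) (hε : 0 < ε) (hε2 : ε < 2) :
    (Nat.clog 2 n : ℝ) ≤ 16 * rate K ε := by
  have h0 : 0 < Nat.clog 2 n := Nat.clog_pos (by norm_num) hn
  obtain ⟨b, hb⟩ := Nat.exists_eq_succ_of_ne_zero h0.ne'
  have h1 : 2 ^ b < n := (Nat.lt_clog_iff_pow_lt (by norm_num)).1 (by omega)
  have h2 : (2 : ℝ) ^ b ≤ kappa K := by
    have e1 : (2 : ℝ) ^ b ≤ nnz K := by exact_mod_cast h1.le.trans (le_nnz hn hK)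
    exact e1.trans (nnz_le_kappa hn hK)
  have h3 := Real.log_le_log (by positivity) h2
  rw [Real.log_pow] at h3
  have h4 := Real.log_two_gt_d9
  have h5 := log_kappa_le_rate hn hK hε hε2
  have h6 := one_le_rate hn hK hε hε2
  rw [hb]
  push_cast
  have h7 : (0 : ℝ) ≤ b := Nat.cast_nonneg b
  nlinarith

/-- Expectation and tail of the number of block updates (`w = 1`) and of their work. -/
lemma totalCost_bounds [NeZero p] (hn : 2 ≤ n) (hK : K.IsIrreducible) (hε : 0 < ε) (hε2 : ε < 2)
    {col : Fin n → Fin p} (hcol : ∀ i j, (supportGraph K).Adj i j → col i ≠ col j)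
    {w : Fin p → ℕ} (hw : 0 < ∑ l, w l) :
    Measurable (totalCost (fun t ω => iterate K col ω t)
      (fun x => IsEpsBalanced ε (scaling K x)) w) ∧
    ∫⁻ ω, totalCost (fun t ω => iterate K col ω t) (fun x => IsEpsBalanced ε (scaling K x)) w ω
      ∂blockLaw p ≤ ENNReal.ofReal (384 * rate K ε * (∑ l, w l : ℕ)) ∧
    ∀ L : ℝ, 0 ≤ L → blockLaw p {ω | ENNReal.ofReal (512 * rate K ε * (∑ l, w l : ℕ) * L) <
      totalCost (fun t ω => iterate K col ω t) (fun x => IsEpsBalanced ε (scaling K x)) w ω} ≤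
        ENNReal.ofReal (Real.exp (1 - 4 * L)) := by
  have hdrift := isDrift_blockUpdate hn hK hcol hε
  have hQ := one_le_rate hn hK hε hε2
  change IsDrift _ _ _ _ _ (32 * p * rate K ε) at hdrift
  set Q := rate K ε
  have hp : (0 : ℝ) < p := by exact_mod_cast NeZero.pos p
  have hQ0 : 0 < Q := by linarith
  have hM : 0 < 32 * p * Q := by positivity
  have hS : (0 : ℝ) < (∑ l, w l : ℕ) := by exact_mod_cast hw
  set S : ℝ := ((∑ l, w l : ℕ) : ℝ) with hSdef
  have hc : 0 < 1 / (128 * Q * S) := by positivity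
  have hcw : ∀ l, 1 / (128 * Q * S) * w l ≤ 1 := by
    intro l
    have h1 : (w l : ℝ) ≤ S := by
      rw [hSdef]
      exact_mod_cast Finset.single_le_sum (f := w) (fun _ _ => Nat.zero_le _) (Finset.mem_univ l)
    rw [one_div, ← div_eq_inv_mul, div_le_one (by positivity)]
    nlinarith
  have hcM : 4 * (32 * p * Q) * (1 / (128 * Q * S)) * (∑ l, (w l : ℝ)) ≤ p := by
    rw [show ∑ l, (w l : ℝ) = S by rw [hSdef]; push_cast; rfl]
    apply le_of_eq
    field_simp
    norm_num
  refine ⟨hdrift.measurable_totalCost w, (hdrift.lintegral_totalCost_le hM w hc hcw hcM).trans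
    (ENNReal.ofReal_le_ofReal ?_), fun L hL => ?_⟩
  · have := Real.exp_one_lt_three
    rw [div_div_eq_mul_div, div_one]
    nlinarith [mul_pos hQ0 hS]
  · refine (hdrift.measure_lt_totalCost_le hM w hc hcw hcM (by positivity)).trans
      (ENNReal.ofReal_le_ofReal (Real.exp_le_exp.2 (le_of_eq ?_)))
    field_simp
    ring

end Bounds

end ParBalance

end

theorem corollary7p3 :
    ∃ (prog : Cmd) (C : ℝ), 0 < C ∧
      ∀ (n Δ : ℕ) (K : Matrix (Fin n) (Fin n) ℝ) (ε : ℝ),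
        2 ≤ n → K.IsIrreducible → maxDeg K = Δ → 0 < ε → ε < 2 →
        ∃ (R : ℕ) (col : Fin n → Fin (Δ + 1)),
          ComputesColouring prog K Δ R col ∧
          (∀ᵐ ω ∂blockLaw (Δ + 1), ∃ T : ℕ, numUpdates K ε col ω = T ∧
            IsEpsBalanced ε (scaling K (iterate K col ω T))) ∧
          (∫⁻ ω, parRounds K ε R col ω ∂blockLaw (Δ + 1) ≤
            ENNReal.ofReal (C * (Δ / ε * min (1 / ε) (dirDiam K) * Real.log (kappa K)))) ∧
          (∫⁻ ω, parWork K ε (netWork prog (neighbours K) Δ R) col ω ∂blockLaw (Δ + 1) ≤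
            ENNReal.ofReal (C * (nnz K / ε * min (1 / ε) (dirDiam K) * Real.log (kappa K)))) ∧
          ∀ δ : ℝ, 0 < δ → δ ≤ 1 / 2 →
            ENNReal.ofReal (1 - δ) ≤ blockLaw (Δ + 1) {ω |
              parRounds K ε R col ω ≤ ENNReal.ofReal
                (C * (Δ / ε * min (1 / ε) (dirDiam K) * Real.log (kappa K) *
                  Real.log (1 / δ))) ∧
              parWork K ε (netWork prog (neighbours K) Δ R) col ω ≤ ENNReal.ofReal
                (C * (nnz K / ε * min (1 / ε) (dirDiam K) * Real.log (kappa K) *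
                  Real.log (1 / δ)))} := by
  refine ⟨colouringCmd, 10000, by norm_num, ?_⟩
  intro n Δ K ε hn hK hΔ hε hε2
  obtain ⟨col, hhalt, hword, hcol, hwork⟩ := exists_colouring (Δ := Δ)
    (mem_neighbours K) fun k => hΔ ▸ length_neighbours_le_maxDeg K k
  set R := 1 + (Nat.clog 2 n + 1) * (Δ + 1) with hR
  set W := netWork colouringCmd (neighbours K) Δ R with hW
  have hΔ1 : 1 ≤ Δ := hΔ ▸ one_le_maxDeg hn hK
  have hΔn : Δ + 1 ≤ n := by
    have := maxDeg_lt hn K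
    omega
  have hnm := le_nnz hn hK
  have hQ1 := one_le_rate hn hK hε hε2
  have hlog := clog_le_rate hn hK hε hε2
  have hN : ∀ a : ℝ, a / ε * min (1 / ε) (dirDiam K) * Real.log (kappa K) = a * rate K ε := by
    intro a
    unfold rate
    ring
  simp only [hN]
  set Q := rate K ε with hQ
  have hQ0 : 0 < Q := by linarith
  set m := nnz K with hm
  have hΔ1' : (1 : ℝ) ≤ Δ := by exact_mod_cast hΔ1
  have hm1 : (1 : ℝ) ≤ m := by exact_mod_cast (by omega : 1 ≤ m)
  have hnm' : (n : ℝ) ≤ m := by exact_mod_cast hnm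
  -- the deterministic parts
  have hR' : ((R + 1 : ℕ) : ℝ) ≤ 64 * (Δ * Q) := by
    rw [hR]
    push_cast
    nlinarith [mul_nonneg (sub_nonneg.2 hΔ1') hQ0.le, mul_nonneg (sub_nonneg.2 hΔ1')
      (sub_nonneg.2 hlog), mul_nonneg (sub_nonneg.2 hΔ1') (sub_nonneg.2 hQ1)]
  have hW' : ((W + (n + m) : ℕ) : ℝ) ≤ 3100 * (m * Q) := by
    have h1 : ∑ k, ((neighbours K k).length + 1) ≤ 3 * m := by
      calc ∑ k, ((neighbours K k).length + 1) ≤ ∑ k, (nnzAt K k + 1) := by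
            gcongr with k
            exact length_neighbours_le_nnzAt K k
        _ = 2 * m + n := by simp [Finset.sum_add_distrib, sum_nnzAt, hm]
        _ ≤ 3 * m := by omega
    have h2 : W ≤ 32 * (Nat.clog 2 n + 2) * (3 * m) :=
      hwork.trans (Nat.mul_le_mul_left _ h1)
    have h3 : (W : ℝ) ≤ 32 * (Nat.clog 2 n + 2) * (3 * m) := by exact_mod_cast h2
    have h4 : 32 * ((Nat.clog 2 n : ℝ) + 2) * (3 * m) ≤ 32 * (32 * Q) * (3 * m) := by
      gcongr
      linarith
    push_cast
    nlinarith
  obtain ⟨hmeasN, hEN, hTN⟩ := totalCost_bounds hn hK hε hε2 hcol (w := fun _ => 1) (by simp)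
  obtain ⟨hmeasW, hEW, hTW⟩ := totalCost_bounds hn hK hε hε2 hcol (w := blockWork K col)
    (by rw [sum_blockWork]; omega)
  rw [sum_blockWork] at hEW hTW
  rw [← hQ] at hEN hTN hEW hTW
  have hsumN : ((∑ _l : Fin (Δ + 1), 1 : ℕ) : ℝ) ≤ 2 * Δ := by
    simp
    linarith
  have hsumW : ((Δ + 1 + n + 2 * m : ℕ) : ℝ) ≤ 4 * m := by
    exact_mod_cast (by omega : Δ + 1 + n + 2 * m ≤ 4 * m)
  have hpar : ∀ ω, parRounds K ε R col ω = (R + 1 : ℕ) +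
      totalCost (fun t ω => iterate K col ω t) (fun x => IsEpsBalanced ε (scaling K x))
        (fun _ => 1) ω := by
    intro ω
    rw [parRounds, numUpdates_eq_totalCost]
    push_cast
    rfl
  -- a deterministic part and a random part within the budget
  have hadd : ∀ (a : ℕ) (b c : ℝ) (y : ℝ≥0∞), 0 ≤ b → (a : ℝ) + b ≤ c → y ≤ ENNReal.ofReal b →
      (a : ℝ≥0∞) + y ≤ ENNReal.ofReal c := by
    intro a b c y hb habc hy
    calc (a : ℝ≥0∞) + y ≤ ENNReal.ofReal a + ENNReal.ofReal b := by
          rw [ENNReal.ofReal_natCast]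
          gcongr
      _ = ENNReal.ofReal (a + b) := (ENNReal.ofReal_add (Nat.cast_nonneg a) hb).symm
      _ ≤ ENNReal.ofReal c := ENNReal.ofReal_le_ofReal habc
  refine ⟨R, col, ⟨hhalt, hword, hcol⟩, ?_, ?_, ?_, ?_⟩
  · filter_upwards [ae_lt_top hmeasN (ne_top_of_le_ne_top ENNReal.ofReal_ne_top hEN)] with ω hω
    refine exists_numUpdates_eq fun htop => ?_
    rw [← numUpdates_eq_totalCost, htop] at hω
    simp at hω
  · simp_rw [hpar]
    rw [lintegral_add_left measurable_const, lintegral_const, measure_univ, mul_one]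
    refine hadd _ _ _ _ (by positivity) ?_ hEN
    have := mul_le_mul_of_nonneg_left hsumN hQ0.le
    nlinarith
  · simp_rw [parWork_eq_add_totalCost]
    rw [lintegral_add_left measurable_const, lintegral_const, measure_univ, mul_one]
    refine hadd _ _ _ _ (by positivity) ?_ hEW
    have := mul_le_mul_of_nonneg_left hsumW hQ0.le
    nlinarith
  · intro δ hδ hδ2
    set L := Real.log (1 / δ) with hL
    have hL1 : 1 ≤ 2 * L := by
      have h1 : Real.log 2 ≤ L :=
        Real.log_le_log (by norm_num) (by rw [le_div_iff₀ hδ]; linarith)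
      have := Real.log_two_gt_d9
      linarith
    have hL0 : 0 ≤ L := by linarith
    set TN := totalCost (fun t ω => iterate K col ω t) (fun x => IsEpsBalanced ε (scaling K x))
      (fun _ => 1)
    set TW := totalCost (fun t ω => iterate K col ω t) (fun x => IsEpsBalanced ε (scaling K x))
      (blockWork K col)
    set E₁ := {ω | ENNReal.ofReal (512 * Q * (∑ _l : Fin (Δ + 1), 1 : ℕ) * L) < TN ω} with hE₁
    set E₂ := {ω | ENNReal.ofReal (512 * Q * (Δ + 1 + n + 2 * m : ℕ) * L) < TW ω} with hE₂
    have hmE₁ : MeasurableSet E₁ := measurableSet_lt measurable_const hmeasN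
    have hmE₂ : MeasurableSet E₂ := measurableSet_lt measurable_const hmeasW
    -- the two bad events have probability at most `e * δ ^ 4` each
    have hexp : Real.exp (1 - 4 * L) + Real.exp (1 - 4 * L) ≤ δ := by
      have h1 : Real.exp (1 - 4 * L) = Real.exp 1 * δ ^ 4 := by
        rw [sub_eq_add_neg, Real.exp_add, hL, one_div, Real.log_inv]
        congr 1
        rw [show -(4 * -Real.log δ) = ((4 : ℕ) : ℝ) * Real.log δ by push_cast; ring,
          Real.exp_nat_mul, Real.exp_log hδ]
      have h2 := Real.exp_one_lt_three
      have h3 : δ ^ 3 ≤ (1 / 2) ^ 3 := by gcongr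
      have h4 : δ ^ 4 = δ ^ 3 * δ := by ring
      rw [h1, h4]
      have h5 : 0 ≤ δ ^ 3 := by positivity
      nlinarith [mul_nonneg h5 hδ.le, mul_le_mul_of_nonneg_right h3 hδ.le]
    have hbad : blockLaw (Δ + 1) (E₁ ∪ E₂) ≤ ENNReal.ofReal δ :=
      calc blockLaw (Δ + 1) (E₁ ∪ E₂) ≤ ENNReal.ofReal (Real.exp (1 - 4 * L)) +
            ENNReal.ofReal (Real.exp (1 - 4 * L)) :=
            (measure_union_le _ _).trans (add_le_add (hTN L hL0) (hTW L hL0))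
        _ ≤ ENNReal.ofReal δ := by
            rw [← ENNReal.ofReal_add (Real.exp_nonneg _) (Real.exp_nonneg _)]
            exact ENNReal.ofReal_le_ofReal hexp
    calc ENNReal.ofReal (1 - δ) = 1 - ENNReal.ofReal δ := by
          rw [ENNReal.ofReal_sub _ hδ.le, ENNReal.ofReal_one]
      _ ≤ 1 - blockLaw (Δ + 1) (E₁ ∪ E₂) := by gcongr
      _ = blockLaw (Δ + 1) (E₁ ∪ E₂)ᶜ := (prob_compl_eq_one_sub (hmE₁.union hmE₂)).symm
      _ ≤ _ := measure_mono ?_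
    intro ω hω
    rw [Set.mem_compl_iff, Set.mem_union, not_or] at hω
    obtain ⟨hω₁, hω₂⟩ := hω
    rw [hE₁, Set.mem_ofPred_eq, not_lt] at hω₁
    rw [hE₂, Set.mem_ofPred_eq, not_lt] at hω₂
    have hmQ : 0 ≤ m * Q := by positivity
    have hΔQ : 0 ≤ Δ * Q := by positivity
    rw [Set.mem_ofPred_eq]
    constructor
    · rw [hpar]
      refine hadd _ _ _ _ (by positivity) ?_ hω₁
      have h1 := mul_le_mul_of_nonneg_left hsumN (mul_nonneg hQ0.le hL0)
      have h2 := mul_le_mul_of_nonneg_left hL1 hΔQ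
      nlinarith [mul_nonneg hΔQ hL0]
    · rw [parWork_eq_add_totalCost]
      refine hadd _ _ _ _ (by positivity) ?_ hω₂
      have h1 := mul_le_mul_of_nonneg_left hsumW (mul_nonneg hQ0.le hL0)
      have h2 := mul_le_mul_of_nonneg_left hL1 hmQ
      nlinarith [mul_nonneg hmQ hL0]
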